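/- **Setting.** Let $\overline{\mathscr H}=\mathbb R\times[0,\infty)$ and $\mathscr H=\mathbb R\times(0,\infty)$. Fix polar-like coordinates on $\mathbb R^2$, that is, a continuous map $\Psi:\overline{\mathscr H}\to\mathbb R^2$, $(\theta,r)\mapsto\Psi(\theta,r)$, which is $2\pi$-periodic in $\theta$, satisfies $\Psi^{-1}(0)=\mathbb R\times\{0\}$, restricts to an orientation preserving local homeomorphism on $\mathscr H$ (its local degree at every point of $\mathscr H$ is $1$), and maps $[0,2\pi)\times(0,\infty)$ bijectively onto $\mathbb R^2\setminus\{0\}$. Write $\deg$ for the Brouwer degree in the plane. Let $U\subset\mathbb R^2$ be open and bounded, and let $\phi:[0,T]\times\overline U\to\mathbb R^2$ be continuous with $\phi(0,x)=x$ for all $x\in\overline U$. Assume that $\phi(t,x)\neq0$ for all $t\in[0,T]$, $x\in\partial U$, and that $\phi(T,x)\ne x$ for all $x\in\partial U$. Put $f_T(x)=\phi(T,x)-x$ on $\overline U$. Let $\Phi:[0,T]\times\Psi^{-1}(\partial U)\to\mathscr H$ be the continuous lift of $\phi$, i.e. $\Phi(0,y)=y$ and $\Psi(\Phi(t,y))=\phi(t,\Psi(y))$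 (such a lift exists and is unique), and put $F_T(y)=\Phi(T,y)-y$ on $\Psi^{-1}(\partial U)$; this map is $2\pi$-periodic in $\theta$. For $x\in\partial U$ let $\operatorname{rot}(F_T,x)=\frac1{2\pi}F_T^\theta(y)$, where $y$ is any point of $\Psi^{-1}(x)$ and $F_T^\theta$ is the first component of $F_T$, and let $$\Sigma(F_T,\partial U)=\mathbb Z\cap\operatorname{conv}\{\operatorname{rot}(F_T,x):x\in\partial U\},$$ a finite set. For $i\in\mathbb Z$ let $\nu_i=(2\pi i,0)$ and define $$\mathfrak D(F_T,U,\nu_i)=\deg(F_{\mathrm{ext}}\circ\Psi^{-1},U,\nu_i),$$ where $F_{\mathrm{ext}}:\overline{\mathscr H}\to\mathbb R^2$ is any continuous extension of $F_T$ that is $2\pi$-periodic in $\theta$ and constant on $\mathbb R\times\{0\}$, and $\Psi^{-1}$ denotes the inverse of the restriction of $\Psi$ to $\{(0,0)\}\cup[0,2\pi)\times(0,\infty)$; the value does not depend on the extension. **Theorem.** Under these assumptions $$\deg(f_T,U,0)=1+\sum_{i\in\Sigma(F_T,\partial U)}\mathfrak D(F_T,U,\nu_i)\quad\text{if }0\in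 U,$$ $$\deg(f_T,U,0)=\sum_{i\in\Sigma(F_T,\partial U)}\mathfrak D(F_T,U,\nu_i)\quad\text{if }0\notin\overline U.$$ -/

import Mathlib

open Set Topology Function

noncomputable section

/-! ## Brouwer degree in the plane -/

/-- `h` is an admissible smooth approximation of `g` for computing the degree of `g` on `U` at `v`:
it is smooth, it is uniformly closer to `g` on `closure U` than `v` is to `g (∂U)`, and `v` is a
regular value of `h` on `U`. -/
structure IsRegularApprox (g : ℝ × ℝ → ℝ × ℝ) (U : Set (ℝ × ℝ)) (v : ℝ × ℝ)
    (h : ℝ × ℝ → ℝ × ℝ) : Prop where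
  smooth : ContDiff ℝ (⊤ : ℕ∞) h
  close : ∀ x ∈ closure U, ∀ z ∈ frontier U, ‖h x - g x‖ < ‖g z - v‖
  regular : ∀ x ∈ U, h x = v → (fderiv ℝ h x).det ≠ 0

/-- The sum of the signs of the Jacobian determinant of `h` over the preimages of `v` in `U`. -/
def signedCount (h : ℝ × ℝ → ℝ × ℝ) (U : Set (ℝ × ℝ)) (v : ℝ × ℝ) : ℤ :=
  ∑ᶠ x ∈ {x | x ∈ U ∧ h x = v}, (SignType.sign (fderiv ℝ h x).det : ℤ)

open Classical in
/-- The Brouwer degree `deg (g, U, v)` of `g`, continuous on `closure U`, with `U` open and bounded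
and `v ∉ g (∂U)`: the signed number of preimages of `v` under any admissible smooth approximation
(the number does not depend on the approximation). -/
def brouwerDegree (g : ℝ × ℝ → ℝ × ℝ) (U : Set (ℝ × ℝ)) (v : ℝ × ℝ) : ℤ :=
  if H : ∃ h, IsRegularApprox g U v h then signedCount H.choose U v else 0

/-! ## Polar-like coordinates -/

/-- The closed half-plane `ℝ × [0, ∞)` of points `(θ, r)`. -/
def closedHalfPlane : Set (ℝ × ℝ) := {y | 0 ≤ y.2}

/-- The open half-plane `ℝ × (0, ∞)`. -/
def openHalfPlane : Set (ℝ × ℝ) := {y | 0 < y.2}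

/-- `Ψ`, considered on the closed half-plane only, defines polar-like coordinates on the plane.
Orientation preserving means that the local degree at every point of the open half-plane is `1`. -/
structure IsPolarLike (Ψ : ℝ × ℝ → ℝ × ℝ) : Prop where
  periodic : ∀ θ r : ℝ, 0 ≤ r → Ψ (θ + 2 * Real.pi, r) = Ψ (θ, r)
  origin : ∀ y ∈ closedHalfPlane, Ψ y = 0 ↔ y.2 = 0
  continuousOn : ContinuousOn Ψ closedHalfPlane
  localHomeo : IsLocalHomeomorphOn Ψ openHalfPlane
  bijOn : BijOn Ψ (Ico 0 (2 * Real.pi) ×ˢ Ioi 0) {0}ᶜ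
  orientation : ∀ y ∈ openHalfPlane,
    ∀ᶠ ε in 𝓝[>] (0 : ℝ), brouwerDegree Ψ (Metric.ball y ε) (Ψ y) = 1

/-- The preimage of `E` under `Ψ` in the closed half-plane. -/
def polarPreimage (Ψ : ℝ × ℝ → ℝ × ℝ) (E : Set (ℝ × ℝ)) : Set (ℝ × ℝ) :=
  {y | y ∈ closedHalfPlane ∧ Ψ y ∈ E}

/-- The inverse of the restriction of `Ψ` to `{(0, 0)} ∪ [0, 2π) × (0, ∞)`. -/
def polarInv (Ψ : ℝ × ℝ → ℝ × ℝ) : ℝ × ℝ → ℝ × ℝ :=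
  invFunOn Ψ ({(0, 0)} ∪ Ico 0 (2 * Real.pi) ×ˢ Ioi 0)

/-! ## Lifts of evolution maps and rotation -/

/-- `Φ` is a continuous lift in polar-like coordinates of `φ : [0, T] × E → ℝ² ∖ {0}`, starting
from the identity. -/
structure IsEvolutionLift (Ψ : ℝ × ℝ → ℝ × ℝ) (T : ℝ) (φ : ℝ → ℝ × ℝ → ℝ × ℝ)
    (E : Set (ℝ × ℝ)) (Φ : ℝ → ℝ × ℝ → ℝ × ℝ) : Prop where
  continuousOn : ContinuousOn (uncurry Φ) (Icc 0 T ×ˢ polarPreimage Ψ E)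
  mem : ∀ t ∈ Icc 0 T, ∀ y ∈ polarPreimage Ψ E, Φ t y ∈ openHalfPlane
  initial : ∀ y ∈ polarPreimage Ψ E, Φ 0 y = y
  lift : ∀ t ∈ Icc 0 T, ∀ y ∈ polarPreimage Ψ E, Ψ (Φ t y) = φ t (Ψ y)

open Classical in
/-- The continuous lift `Φ` of `φ` (unique on `[0, T] × Ψ⁻¹(E)`). -/
def evolutionLift (Ψ : ℝ × ℝ → ℝ × ℝ) (T : ℝ) (φ : ℝ → ℝ × ℝ → ℝ × ℝ)
    (E : Set (ℝ × ℝ)) : ℝ → ℝ × ℝ → ℝ × ℝ :=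
  if H : ∃ Φ, IsEvolutionLift Ψ T φ E Φ then H.choose else fun _ y => y

/-- `F_T (y) = Φ (T, y) - y` for `y ∈ Ψ⁻¹(E)`. -/
def liftedDisplacement (Ψ : ℝ × ℝ → ℝ × ℝ) (T : ℝ) (φ : ℝ → ℝ × ℝ → ℝ × ℝ)
    (E : Set (ℝ × ℝ)) : ℝ × ℝ → ℝ × ℝ :=
  fun y => evolutionLift Ψ T φ E T y - y

/-- The rotation associated with the point `x` with respect to `F`, a map that is `2π`-periodic in
the angle. -/
def polarRotation (Ψ F : ℝ × ℝ → ℝ × ℝ) (x : ℝ × ℝ) : ℝ :=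
  (F (polarInv Ψ x)).1 / (2 * Real.pi)

/-- The set `Σ (F, E)` of the integers in the convex hull of the rotations of the points of `E`. -/
def rotationIntegers (Ψ F : ℝ × ℝ → ℝ × ℝ) (E : Set (ℝ × ℝ)) : Set ℤ :=
  {i | (i : ℝ) ∈ convexHull ℝ (polarRotation Ψ F '' E)}

/-! ## The degree in polar-like coordinates -/

/-- `G` is a continuous extension of `F` from `Ψ⁻¹(∂U)` to the closed half-plane, `2π`-periodic in
the angle and constant on the line `r = 0`. -/
structure IsPolarExtension (Ψ F : ℝ × ℝ → ℝ × ℝ) (U : Set (ℝ × ℝ))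
    (G : ℝ × ℝ → ℝ × ℝ) : Prop where
  continuousOn : ContinuousOn G closedHalfPlane
  periodic : ∀ θ r : ℝ, 0 ≤ r → G (θ + 2 * Real.pi, r) = G (θ, r)
  eqOn : EqOn G F (polarPreimage Ψ (frontier U))
  const : ∃ v₀ : ℝ × ℝ, ∀ θ : ℝ, G (θ, 0) = v₀

open Classical in
/-- The degree `𝔇 (F, U, v) = deg (F_ext ∘ Ψ⁻¹, U, v)`, for any extension `F_ext` of `F` as above
(the value does not depend on the extension). -/
def polarDegree (Ψ F : ℝ × ℝ → ℝ × ℝ) (U : Set (ℝ × ℝ)) (v : ℝ × ℝ) : ℤ :=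
  if H : ∃ G, IsPolarExtension Ψ F U G then brouwerDegree (H.choose ∘ polarInv Ψ) U v else 0

/-- The value `ν_i = (2πi, 0)`. -/
def rotationValue (i : ℤ) : ℝ × ℝ := (2 * Real.pi * i, 0)

end

/-! On `∂U` the final map adds `w = F_T ∘ Ψ⁻¹` to the polar-like coordinates of `x`, that is `φ T x
= polarShift Ψ x (w x)`. A point `x ≠ 0` is fixed by such a shift exactly when `w x` is some `ν_i`,
because the fibres of `Ψ` over nonzero points are orbits of the angular translations. The degree of
`φ T x - x` depends only on boundary values, so `φ T` may be replaced inside `U` by the shift along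
any convenient extension `g` of `w`.

Away from the origin, zeros of the new displacement are the points with `g x = ν_i`. After
perturbing `g` so that every `ν_i` is a regular value, the index at such a zero `x₀` is found by
freezing the base point: `Ψ(y + w) - Ψ(y)`, with `w` now measured from `ν_i`, is deformed to `Ψ(y₀ +
w) - Ψ(y₀)`. Since `Ψ` has local degree `1`, the index is the sign of the Jacobian of `g`
(`brouwerDegree_polarShift_ball`). Summation gives the sum of the degrees of `g` at all `ν_i`
(`brouwerDegree_polarShift`).

If `0 ∈ U`, the extension is chosen so that the shift collapses a neighbourhood of `0` to `0`. The
displacement there is `-x`, which has index `1` in the plane and is not seen by the `ν_i`: this is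
the extra summand (`exists_extension_of_zero_mem`). For `i` outside `Σ`, the first component of `g -
ν_i` has one sign on `∂U`, so the degree vanishes.

The degree is defined through a chosen smooth approximation. Its independence of the choice
(`IsRegularApprox.signedCount_eq`) comes from writing the signed count as the integral of a pulled
back area form; homotopy invariance, additivity and the composition rule follow. -/

/-! ## Jacobian determinants in the plane -/

/-- The Jacobian determinant of the pair `(p, q)` of functions on the plane. -/
noncomputable def planeJacobian (p q : ℝ × ℝ → ℝ) (x : ℝ × ℝ) : ℝ :=
  fderiv ℝ p x (1, 0) * fderiv ℝ q x (0, 1) - fderiv ℝ p x (0, 1) * fderiv ℝ q x (1, 0)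

theorem planeJacobian_swap (p q : ℝ × ℝ → ℝ) (x : ℝ × ℝ) :
    planeJacobian q p x = -planeJacobian p q x := by
  unfold planeJacobian; ring

theorem det_prod_plane (L : ℝ × ℝ →L[ℝ] ℝ × ℝ) :
    L.det = (L (1, 0)).1 * (L (0, 1)).2 - (L (0, 1)).1 * (L (1, 0)).2 := by
  rw [ContinuousLinearMap.det, ← LinearMap.det_toMatrix (Module.Basis.finTwoProd ℝ),
    Matrix.det_fin_two]
  simp [LinearMap.toMatrix_apply]

theorem det_fderiv_eq_planeJacobian {h : ℝ × ℝ → ℝ × ℝ} {x : ℝ × ℝ}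
    (hh : DifferentiableAt ℝ h x) :
    (fderiv ℝ h x).det = planeJacobian (fun y => (h y).1) (fun y => (h y).2) x := by
  rw [det_prod_plane, planeJacobian, fderiv.fst hh, fderiv.snd hh]
  simp

theorem continuous_planeJacobian {p q : ℝ × ℝ → ℝ} (hp : ContDiff ℝ 1 p) (hq : ContDiff ℝ 1 q) :
    Continuous (planeJacobian p q) := by
  unfold planeJacobian
  have h1 := hp.continuous_fderiv one_ne_zero
  have h2 := hq.continuous_fderiv one_ne_zero
  fun_prop

theorem planeJacobian_of_eventuallyEq_zero {p q : ℝ × ℝ → ℝ} {x : ℝ × ℝ}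
    (hp : p =ᶠ[𝓝 x] fun _ => 0) : planeJacobian p q x = 0 := by
  simp [planeJacobian, hp.fderiv_eq]

-- This is Stokes for `dk ∧ db = d(k db)` with compact support: integrating each product by parts
-- leaves the mixed second derivatives of `b`, which cancel by symmetry.
open MeasureTheory in
theorem integral_planeJacobian_eq_zero {k b : ℝ × ℝ → ℝ} (hk : ContDiff ℝ 1 k)
    (hks : HasCompactSupport k) (hb : ContDiff ℝ 2 b) : ∫ x, planeJacobian k b x = 0 := by
  have hk' := hk.continuous_fderiv one_ne_zero
  have hkd : Differentiable ℝ k := hk.differentiable one_ne_zero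
  have hb' : ContDiff ℝ 1 (fderiv ℝ b) := hb.fderiv_right (by norm_num)
  have hbv (v : ℝ × ℝ) : ContDiff ℝ 1 (fun x => fderiv ℝ b x v) := hb'.clm_apply contDiff_const
  have hbv' (v w : ℝ × ℝ) : Continuous (fun x => fderiv ℝ (fun x => fderiv ℝ b x v) x w) :=
    ((hbv v).continuous_fderiv one_ne_zero).clm_apply continuous_const
  have hks' (v : ℝ × ℝ) : HasCompactSupport (fun x => fderiv ℝ k x v) := hks.fderiv_apply ℝ v
  have i1 (v w : ℝ × ℝ) : Integrable (fun x => fderiv ℝ k x v * fderiv ℝ b x w) :=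
    Continuous.integrable_of_hasCompactSupport
      (by have := (hbv w).continuous; fun_prop) ((hks' v).mul_right)
  have i2 (v w : ℝ × ℝ) : Integrable (fun x => k x * fderiv ℝ (fun x => fderiv ℝ b x v) x w) :=
    Continuous.integrable_of_hasCompactSupport
      (hk.continuous.mul (hbv' v w)) (hks.mul_right)
  have i3 (v : ℝ × ℝ) : Integrable (fun x => k x * fderiv ℝ b x v) :=
    Continuous.integrable_of_hasCompactSupport
      (hk.continuous.mul (hbv v).continuous) (hks.mul_right)
  have key (v w : ℝ × ℝ) := integral_mul_fderiv_eq_neg_fderiv_mul_of_integrable (i1 v w)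
    (i2 w v) (i3 w) (fun x _ => hkd x) (fun x _ => (hbv w).differentiable one_ne_zero x)
  have symm (x : ℝ × ℝ) : fderiv ℝ (fun x => fderiv ℝ b x (0, 1)) x (1, 0)
      = fderiv ℝ (fun x => fderiv ℝ b x (1, 0)) x (0, 1) := by
    have hd : DifferentiableAt ℝ (fderiv ℝ b) x := hb'.differentiable one_ne_zero x
    have e (v w : ℝ × ℝ) : fderiv ℝ (fun x => fderiv ℝ b x v) x w
        = fderiv ℝ (fderiv ℝ b) x w v := by
      rw [fderiv_clm_apply hd (differentiableAt_const v)]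
      simp
    rw [e, e]
    exact (hb.contDiffAt.isSymmSndFDerivAt (by simp)) _ _
  unfold planeJacobian
  rw [integral_sub (i1 _ _) (i1 _ _)]
  have k1 := key (1, 0) (0, 1)
  have k2 := key (0, 1) (1, 0)
  simp only [symm] at k1
  linarith

theorem contDiff_one_integral {α : ℝ → ℝ} (hα : Continuous α) (c : ℝ) :
    ContDiff ℝ 1 fun t => ∫ s in c..t, α s := by
  have hd (t : ℝ) : HasDerivAt (fun t => ∫ s in c..t, α s) (α t) t :=
    (hα.integral_hasStrictDerivAt c t).hasDerivAt
  refine contDiff_one_iff_deriv.2 ⟨fun t => (hd t).differentiableAt, ?_⟩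
  rwa [show deriv (fun t => ∫ s in c..t, α s) = α from funext fun t => (hd t).deriv]

theorem integrableOn_of_isBounded {f : ℝ × ℝ → ℝ} {U : Set (ℝ × ℝ)} (hf : Continuous f)
    (hU : Bornology.IsBounded U) : MeasureTheory.IntegrableOn f U :=
  (hf.continuousOn.integrableOn_compact hU.isCompact_closure).mono_set subset_closure

open MeasureTheory in
/-- Invariance of the integral of a pulled back area form under a change of the first component
which does not meet the support of the form on the boundary. -/
theorem setIntegral_pullback_congr_fst {U : Set (ℝ × ℝ)} (hUo : IsOpen U)
    (hUb : Bornology.IsBounded U) {a₀ a₁ b : ℝ × ℝ → ℝ} (ha₀ : ContDiff ℝ 2 a₀)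
    (ha₁ : ContDiff ℝ 2 a₁) (hb : ContDiff ℝ 2 b) {v₁ v₂ δ : ℝ} (hδ : 0 < δ)
    {α β : ℝ → ℝ} (hα : Continuous α) (hβ : ContDiff ℝ 1 β)
    (hαs : ∀ t, δ < |t - v₁| → α t = 0) (hβs : ∀ t, δ < |t - v₂| → β t = 0)
    (hfr : ∀ x ∈ frontier U, ∀ t ∈ uIcc (a₀ x) (a₁ x), δ < |t - v₁| ∨ δ < |b x - v₂|) :
    ∫ x in U, α (a₀ x) * β (b x) * planeJacobian a₀ b x =
      ∫ x in U, α (a₁ x) * β (b x) * planeJacobian a₁ b x := by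
  classical
  let A : ℝ → ℝ := fun t => ∫ s in (0 : ℝ)..t, α s
  have hA : ContDiff ℝ 1 A := contDiff_one_integral hα 0
  have hAd (t : ℝ) : HasDerivAt A (α t) t := (hα.integral_hasStrictDerivAt 0 t).hasDerivAt
  have hAsub (s t : ℝ) : A t - A s = ∫ r in s..t, α r :=
    intervalIntegral.integral_interval_sub_left (hα.intervalIntegrable _ _)
      (hα.intervalIntegrable _ _)
  have ha₀' : ContDiff ℝ 1 a₀ := ha₀.of_le (by norm_num)
  have ha₁' : ContDiff ℝ 1 a₁ := ha₁.of_le (by norm_num)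
  have hb' : ContDiff ℝ 1 b := hb.of_le (by norm_num)
  -- The two integrands differ by the Jacobian of `(k₀, b)`, where `A` is a primitive of `α`. The
  -- boundary hypothesis makes `k₀` vanish near `∂U`, so its extension by zero is `C¹` with compact
  -- support.
  let k₀ : ℝ × ℝ → ℝ := fun x => (A (a₁ x) - A (a₀ x)) * β (b x)
  have hk₀ : ContDiff ℝ 1 k₀ := ((hA.comp ha₁').sub (hA.comp ha₀')).mul (hβ.comp hb')
  let k : ℝ × ℝ → ℝ := U.indicator k₀
  have hAzero (s t : ℝ) (h : ∀ r ∈ uIcc s t, δ < |r - v₁|) : A t - A s = 0 := by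
    rw [hAsub, intervalIntegral.integral_congr (g := fun _ => 0) fun r hr => hαs r (h r hr)]
    simp
  have hk_out : ∀ x ∉ U, k =ᶠ[𝓝 x] fun _ => 0 := by
    intro x hx
    by_cases hxc : x ∈ closure U
    · have hxf : x ∈ frontier U := by rw [hUo.frontier_eq]; exact ⟨hxc, hx⟩
      suffices h : ∀ᶠ y in 𝓝 x, k₀ y = 0 by
        filter_upwards [h] with y hy
        simp only [k, indicator_apply, hy, ite_self]
      by_cases hbx : δ < |b x - v₂|
      · have : ∀ᶠ y in 𝓝 x, δ < |b y - v₂| :=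
          continuousAt_const.eventually_lt (by have := hb.continuous; fun_prop) hbx
        filter_upwards [this] with y hy
        simp [k₀, hβs _ hy]
      · have hall : ∀ t ∈ uIcc (a₀ x) (a₁ x), δ < |t - v₁| :=
          fun t ht => (hfr x hxf t ht).resolve_right hbx
        have h0 := hall _ left_mem_uIcc
        have h1 := hall _ right_mem_uIcc
        have c0 := ha₀.continuous
        have c1 := ha₁.continuous
        -- The whole segment avoids the `δ`-neighbourhood of `v₁`, so both endpoints lie strictly on
        -- the same side of it; this persists at nearby points.
        have hv : v₁ ∉ uIcc (a₀ x) (a₁ x) := fun hv => by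
          have := hall _ hv
          rw [sub_self, abs_zero] at this
          linarith
        rw [mem_uIcc, not_or, not_and, not_and] at hv
        have hconst : ∀ᶠ y in 𝓝 x, ∀ r ∈ uIcc (a₀ y) (a₁ y), δ < |r - v₁| := by
          rcases lt_abs.1 h0 with h0 | h0 <;> rcases lt_abs.1 h1 with h1 | h1
          · filter_upwards [c0.continuousAt.eventually_const_lt (by linarith : v₁ + δ < a₀ x),
              c1.continuousAt.eventually_const_lt (by linarith : v₁ + δ < a₁ x)] with y h2 h3 r hr
            have : v₁ + δ < r := (lt_min h2 h3).trans_le hr.1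
            exact lt_abs.2 (Or.inl (by linarith))
          · exact absurd (by linarith) (hv.2 (by linarith))
          · exact absurd (by linarith) (hv.1 (by linarith))
          · filter_upwards [c0.continuousAt.eventually_lt_const (by linarith : a₀ x < v₁ - δ),
              c1.continuousAt.eventually_lt_const (by linarith : a₁ x < v₁ - δ)] with y h2 h3 r hr
            have : r < v₁ - δ := hr.2.trans_lt (max_lt h2 h3)
            exact lt_abs.2 (Or.inr (by linarith))
        filter_upwards [hconst] with y hy
        simp [k₀, hAzero _ _ hy]
    · filter_upwards [isClosed_closure.isOpen_compl.mem_nhds hxc] with y hy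
      exact indicator_of_notMem (fun h => hy (subset_closure h)) _
  have hk_in : ∀ x ∈ U, k =ᶠ[𝓝 x] k₀ := fun x hx => by
    filter_upwards [hUo.mem_nhds hx] with y hy
    exact indicator_of_mem hy _
  have hk : ContDiff ℝ 1 k := contDiff_iff_contDiffAt.2 fun x => by
    by_cases hx : x ∈ U
    · exact hk₀.contDiffAt.congr_of_eventuallyEq (hk_in x hx)
    · exact contDiffAt_const.congr_of_eventuallyEq (hk_out x hx)
  have hks : HasCompactSupport k := HasCompactSupport.intro hUb.isCompact_closure fun x hx =>
    indicator_of_notMem (fun h => hx (subset_closure h)) _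
  have hfd (x : ℝ × ℝ) : HasFDerivAt k₀
      ((A (a₁ x) - A (a₀ x)) • (deriv β (b x) • fderiv ℝ b x) +
        β (b x) • (α (a₁ x) • fderiv ℝ a₁ x - α (a₀ x) • fderiv ℝ a₀ x)) x := by
    have d0 := (ha₀'.differentiable one_ne_zero x).hasFDerivAt
    have d1 := (ha₁'.differentiable one_ne_zero x).hasFDerivAt
    have d2 := (hb'.differentiable one_ne_zero x).hasFDerivAt
    have d3 := (hβ.differentiable one_ne_zero (b x)).hasDerivAt
    exact (((hAd _).comp_hasFDerivAt x d1).sub ((hAd _).comp_hasFDerivAt x d0)).mul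
      (d3.comp_hasFDerivAt x d2)
  -- The term containing `deriv β` is a multiple of `db` and drops out of the Jacobian with `b`.
  have hjac : planeJacobian k b = U.indicator fun x =>
      α (a₁ x) * β (b x) * planeJacobian a₁ b x - α (a₀ x) * β (b x) * planeJacobian a₀ b x := by
    funext x
    by_cases hx : x ∈ U
    · rw [indicator_of_mem hx, planeJacobian, (hk_in x hx).fderiv_eq, (hfd x).fderiv]
      simp only [planeJacobian, add_apply, smul_apply,
        sub_apply, smul_eq_mul]
      ring
    · rw [indicator_of_notMem hx, planeJacobian_of_eventuallyEq_zero (hk_out x hx)]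
  have h0 := integral_planeJacobian_eq_zero hk hks hb
  rw [hjac, integral_indicator hUo.measurableSet, integral_sub] at h0
  · linarith
  all_goals
    refine integrableOn_of_isBounded ?_ hUb
    have := continuous_planeJacobian ha₀' hb'
    have := continuous_planeJacobian ha₁' hb'
    have := hβ.continuous
    have := ha₀.continuous
    have := ha₁.continuous
    have := hb.continuous
    fun_prop

/-! ### Regular values: counting preimages by an integral -/

theorem exists_injOn_sign_const {h : ℝ × ℝ → ℝ × ℝ} (hh : ContDiff ℝ (⊤ : ℕ∞) h) {x : ℝ × ℝ}
    (hx : (fderiv ℝ h x).det ≠ 0) {W : Set (ℝ × ℝ)} (hW : W ∈ 𝓝 x) :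
    ∃ N ⊆ W, IsOpen N ∧ x ∈ N ∧ InjOn h N ∧ h '' N ∈ 𝓝 (h x) ∧
      ∀ y ∈ N, SignType.sign (fderiv ℝ h y).det = SignType.sign (fderiv ℝ h x).det := by
  let e := (fderiv ℝ h x).toContinuousLinearEquivOfDetNeZero hx
  have hs : HasStrictFDerivAt h (e : ℝ × ℝ →L[ℝ] ℝ × ℝ) x := by
    rw [ContinuousLinearMap.coe_toContinuousLinearEquivOfDetNeZero]
    exact hh.contDiffAt.hasStrictFDerivAt (by simp)
  have hdet : Continuous fun y => (fderiv ℝ h y).det :=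
    ContinuousLinearMap.continuous_det.comp (hh.continuous_fderiv (by simp))
  have hsign : ∀ᶠ y in 𝓝 x, SignType.sign (fderiv ℝ h y).det = SignType.sign (fderiv ℝ h x).det := by
    rcases lt_or_gt_of_ne hx with h0 | h0
    · filter_upwards [hdet.continuousAt.eventually_lt_const h0] with y hy
      rw [sign_neg hy, sign_neg h0]
    · filter_upwards [hdet.continuousAt.eventually_const_lt h0] with y hy
      rw [sign_pos hy, sign_pos h0]
  let P := hs.toOpenPartialHomeomorph h
  have hP : P.source ∈ 𝓝 x := P.open_source.mem_nhds hs.mem_toOpenPartialHomeomorph_source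
  obtain ⟨N, hN, hNo, hxN⟩ := mem_nhds_iff.1 (Filter.inter_mem (Filter.inter_mem hW hP) hsign)
  refine ⟨N, fun y hy => (hN hy).1.1, hNo, hxN, ?_, ?_, fun y hy => (hN hy).2⟩
  · exact P.injOn.mono fun y hy => (hN hy).1.2
  · rw [← hs.map_nhds_eq_of_equiv]
    exact Filter.image_mem_map (hNo.mem_nhds hxN)

/-- The preimage is compact because `v` is missed on the frontier, and discrete by the inverse
function theorem. -/
theorem finite_preimage_of_regular {h : ℝ × ℝ → ℝ × ℝ} (hh : ContDiff ℝ (⊤ : ℕ∞) h)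
    {U : Set (ℝ × ℝ)} (hUb : Bornology.IsBounded U) {v : ℝ × ℝ}
    (hfr : ∀ x ∈ frontier U, h x ≠ v) (hreg : ∀ x ∈ U, h x = v → (fderiv ℝ h x).det ≠ 0) :
    {x | x ∈ U ∧ h x = v}.Finite := by
  have hcl : {x | x ∈ U ∧ h x = v} = closure U ∩ h ⁻¹' {v} := by
    ext x
    refine ⟨fun hx => ⟨subset_closure hx.1, hx.2⟩, fun hx => ⟨?_, hx.2⟩⟩
    by_contra hxU
    exact hfr x ⟨hx.1, fun hi => hxU (interior_subset hi)⟩ hx.2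
  have hcpt : IsCompact {x | x ∈ U ∧ h x = v} := by
    rw [hcl]
    exact hUb.isCompact_closure.inter_right (isClosed_singleton.preimage hh.continuous)
  refine hcpt.finite (isDiscrete_iff_forall_mem_exists_isOpen.2 fun x hx => ?_)
  obtain ⟨N, -, hNo, hxN, hinj, -, -⟩ := exists_injOn_sign_const hh (hreg x hx.1 hx.2)
    Filter.univ_mem
  refine ⟨N, hNo, ?_⟩
  ext y
  constructor
  · rintro ⟨hy2, hy1⟩
    exact hinj hy2 hxN (hy1.2.trans hx.2.symm) |>.symm ▸ mem_singleton _
  · rintro rfl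
    exact ⟨hxN, hx⟩

open MeasureTheory in
/-- The signed count of preimages of a regular value as an integral. -/
theorem exists_integral_eq_signedCount {h : ℝ × ℝ → ℝ × ℝ} (hh : ContDiff ℝ (⊤ : ℕ∞) h)
    {U : Set (ℝ × ℝ)} (hUo : IsOpen U) (hUb : Bornology.IsBounded U) {v : ℝ × ℝ}
    (hfr : ∀ x ∈ frontier U, h x ≠ v) (hreg : ∀ x ∈ U, h x = v → (fderiv ℝ h x).det ≠ 0) :
    ∃ δ > 0, ∀ ω : ℝ × ℝ → ℝ, Continuous ω → (∀ y, δ ≤ dist y v → ω y = 0) → ∫ y, ω y = 1 →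
      ∫ x in U, ω (h x) * (fderiv ℝ h x).det = signedCount h U v := by
  classical
  have hfin := finite_preimage_of_regular hh hUb hfr hreg
  obtain ⟨Z, hZ⟩ := hfin.exists_finset_coe
  have hZmem : ∀ z, z ∈ Z ↔ z ∈ U ∧ h z = v := fun z => by
    rw [← Finset.mem_coe, hZ]; rfl
  obtain ⟨D, hD, hDdisj⟩ := Z.finite_toSet.t2_separation
  have hloc : ∀ z : ℝ × ℝ, ∃ N : Set (ℝ × ℝ), z ∈ Z → N ⊆ U ∩ D z ∧ IsOpen N ∧ z ∈ N ∧
      InjOn h N ∧ h '' N ∈ 𝓝 v ∧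
      ∀ y ∈ N, SignType.sign (fderiv ℝ h y).det = SignType.sign (fderiv ℝ h z).det := by
    intro z
    by_cases hz : z ∈ Z
    · have hz' := (hZmem z).1 hz
      obtain ⟨N, h1, h2, h3, h4, h5, h6⟩ := exists_injOn_sign_const hh (hreg z hz'.1 hz'.2)
        (Filter.inter_mem (hUo.mem_nhds hz'.1) ((hD z).2.mem_nhds (hD z).1))
      exact ⟨N, fun _ => ⟨h1, h2, h3, h4, hz'.2 ▸ h5, h6⟩⟩
    · exact ⟨∅, fun h => absurd h hz⟩
  choose N hN using hloc
  have hNo : IsOpen (⋃ z ∈ Z, N z) := isOpen_biUnion fun z hz => (hN z hz).2.1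
  -- Below this `δ`, every sheet `N z` covers the ball around `v`, and the compact remainder of
  -- `closure U` stays outside it. Hence a form supported in the ball is integrated once over each
  -- sheet and nowhere else.
  have hball : ∃ δ > 0, (∀ z ∈ Z, Metric.ball v δ ⊆ h '' N z) ∧
      ∀ x ∈ closure U \ ⋃ z ∈ Z, N z, δ ≤ dist (h x) v := by
    have h1 : ∀ᶠ δ in 𝓝[>] (0 : ℝ), ∀ z ∈ Z, Metric.ball v δ ⊆ h '' N z := by
      rw [Filter.eventually_all_finset]
      intro z hz
      obtain ⟨ε, hε, hεs⟩ := Metric.mem_nhds_iff.1 (hN z hz).2.2.2.2.1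
      filter_upwards [Ioo_mem_nhdsGT hε] with δ hδ
      exact (Metric.ball_subset_ball hδ.2.le).trans hεs
    have h2 : ∀ᶠ δ in 𝓝[>] (0 : ℝ), ∀ x ∈ closure U \ ⋃ z ∈ Z, N z, δ ≤ dist (h x) v := by
      have hK : IsCompact (closure U \ ⋃ z ∈ Z, N z) := hUb.isCompact_closure.diff hNo
      rcases (closure U \ ⋃ z ∈ Z, N z).eq_empty_or_nonempty with he | hne
      · simp [he]
      · obtain ⟨x₀, hx₀, hmin⟩ := hK.exists_isMinOn hne
          (f := fun x => dist (h x) v) (hh.continuous.dist continuous_const).continuousOn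
        have hpos : 0 < dist (h x₀) v := by
          refine dist_pos.2 fun heq => ?_
          by_cases hxU : x₀ ∈ U
          · have hz := (hZmem x₀).2 ⟨hxU, heq⟩
            exact hx₀.2 (mem_biUnion hz (hN x₀ hz).2.2.1)
          · exact hfr x₀ (by rw [hUo.frontier_eq]; exact ⟨hx₀.1, hxU⟩) heq
        filter_upwards [Ioo_mem_nhdsGT hpos] with δ hδ x hx
        exact hδ.2.le.trans (hmin hx)
    obtain ⟨δ, hδ, hδ0⟩ := ((h1.and h2).and self_mem_nhdsWithin).exists
    exact ⟨δ, hδ0, hδ.1, hδ.2⟩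
  obtain ⟨δ, hδ, hδ1, hδ2⟩ := hball
  refine ⟨δ, hδ, fun ω hω hωs hω1 => ?_⟩
  have hdet : Continuous fun y => (fderiv ℝ h y).det :=
    ContinuousLinearMap.continuous_det.comp (hh.continuous_fderiv (by simp))
  set f : ℝ × ℝ → ℝ := fun x => ω (h x) * (fderiv ℝ h x).det with hf
  have hfc : Continuous f := (hω.comp hh.continuous).mul hdet
  have hNU : (⋃ z ∈ Z, N z) ⊆ U := iUnion₂_subset fun z hz => (hN z hz).1.trans inter_subset_left
  have hsplit : ∫ x in U, f x = ∫ x in ⋃ z ∈ Z, N z, f x := by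
    refine setIntegral_eq_of_subset_of_forall_sdiff_eq_zero hUo.measurableSet hNU fun x hx => ?_
    simp [hf, hωs _ (hδ2 x ⟨subset_closure hx.1, hx.2⟩)]
  rw [hsplit, integral_biUnion_finset Z (fun z hz => (hN z hz).2.1.measurableSet)
    (fun z hz w hw hzw => (hDdisj hz hw hzw).mono ((hN z hz).1.trans inter_subset_right)
      ((hN w hw).1.trans inter_subset_right))
    (fun z hz => integrableOn_of_isBounded hfc (hUb.subset ((hN z hz).1.trans inter_subset_left)))]
  have hsc : signedCount h U v = ∑ z ∈ Z, (SignType.sign (fderiv ℝ h z).det : ℤ) := by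
    rw [signedCount, ← hZ, finsum_mem_coe_finset]
  rw [hsc, Int.cast_sum]
  refine Finset.sum_congr rfl fun z hz => ?_
  obtain ⟨-, hNzo, -, hinj, -, hsign⟩ := hN z hz
  have hcov := integral_image_eq_integral_abs_det_fderiv_smul volume hNzo.measurableSet
    (fun x _ => (hh.differentiable (by simp) x).hasFDerivAt.hasFDerivWithinAt) hinj ω
  have himg : ∫ y in h '' N z, ω y = 1 := by
    rw [setIntegral_eq_integral_of_forall_compl_eq_zero, hω1]
    intro y hy
    refine hωs y ?_
    by_contra hlt
    exact hy (hδ1 z hz (Metric.mem_ball.2 (not_le.1 hlt)))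
  rw [himg] at hcov
  -- The change of variables produces `|det|`; the sign is constant on the sheet and can be taken
  -- out.
  have : ∀ x ∈ N z, f x = (SignType.sign (fderiv ℝ h z).det : ℝ) *
      (|(fderiv ℝ h x).det| • ω (h x)) := by
    intro x hx
    rw [← hsign x hx, smul_eq_mul, ← mul_assoc, sign_mul_abs, hf]
    ring
  rw [setIntegral_congr_fun hNzo.measurableSet this, integral_const_mul, ← hcov, mul_one]
  norm_cast

/-! ### Independence of the degree from the approximation -/

theorem eq_empty_of_frontier_eq_empty {U : Set (ℝ × ℝ)} (hUb : Bornology.IsBounded U)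
    (h : frontier U = ∅) : U = ∅ := by
  rcases frontier_eq_empty_iff.1 h with h | h
  · exact h
  · exact absurd (h ▸ hUb) (NormedSpace.unbounded_univ ℝ (ℝ × ℝ))

theorem signedCount_empty (h : ℝ × ℝ → ℝ × ℝ) (v : ℝ × ℝ) : signedCount h ∅ v = 0 := by
  simp [signedCount]

theorem IsRegularApprox.ne_of_mem_frontier {g h : ℝ × ℝ → ℝ × ℝ} {U : Set (ℝ × ℝ)} {v : ℝ × ℝ}
    (H : IsRegularApprox g U v h) : ∀ x ∈ frontier U, h x ≠ v := fun x hx he => by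
  have := H.close x (frontier_subset_closure hx) x hx
  rw [he, norm_sub_rev] at this
  exact lt_irrefl _ this

-- Both counts are integrals of the pullback of the same bump form at `v`. The components are
-- exchanged one at a time, through the pair `(h₁.1, h₀.2)`; both maps are so close to `g` on the
-- frontier that the support of the form is never met there.
open MeasureTheory in
theorem IsRegularApprox.signedCount_eq {g h₀ h₁ : ℝ × ℝ → ℝ × ℝ} {U : Set (ℝ × ℝ)} {v : ℝ × ℝ}
    (hUo : IsOpen U) (hUb : Bornology.IsBounded U) (hg : ContinuousOn g (closure U))
    (H₀ : IsRegularApprox g U v h₀) (H₁ : IsRegularApprox g U v h₁) :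
    signedCount h₀ U v = signedCount h₁ U v := by
  rcases (frontier U).eq_empty_or_nonempty with he | hne
  -- With an empty frontier the closeness condition is vacuous, but then a bounded `U` is empty.
  · rw [eq_empty_of_frontier_eq_empty hUb he, signedCount_empty, signedCount_empty]
  have hfrc : IsCompact (frontier U) :=
    hUb.isCompact_closure.of_isClosed_subset isClosed_frontier frontier_subset_closure
  obtain ⟨z₀, hz₀, hmin⟩ := hfrc.exists_isMinOn hne (f := fun z => ‖g z - v‖)
    ((hg.mono frontier_subset_closure).sub continuousOn_const).norm
  have hbound (h : ℝ × ℝ → ℝ × ℝ) (H : IsRegularApprox g U v h) :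
      ∃ M < ‖g z₀ - v‖, ∀ x ∈ closure U, ‖h x - g x‖ ≤ M := by
    obtain ⟨x₀, hx₀, hmax⟩ := hUb.isCompact_closure.exists_isMaxOn
      (hne.mono frontier_subset_closure) (f := fun x => ‖h x - g x‖)
      (H.smooth.continuous.continuousOn.sub hg).norm
    exact ⟨_, H.close x₀ hx₀ z₀ hz₀, fun x hx => hmax hx⟩
  obtain ⟨M₀, hM₀, hM₀'⟩ := hbound h₀ H₀
  obtain ⟨M₁, hM₁, hM₁'⟩ := hbound h₁ H₁
  obtain ⟨δ₀, hδ₀, hI₀⟩ := exists_integral_eq_signedCount H₀.smooth hUo hUb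
    H₀.ne_of_mem_frontier H₀.regular
  obtain ⟨δ₁, hδ₁, hI₁⟩ := exists_integral_eq_signedCount H₁.smooth hUo hUb
    H₁.ne_of_mem_frontier H₁.regular
  -- The first two bounds make both integral formulas valid; the other two keep the bump away from
  -- the boundary values of both maps.
  obtain ⟨δ, hδ, hδlt⟩ : ∃ δ > 0, δ < δ₀ ∧ δ < δ₁ ∧ δ < ‖g z₀ - v‖ - M₀ ∧ δ < ‖g z₀ - v‖ - M₁ := by
    have : 0 < min (min δ₀ δ₁) (min (‖g z₀ - v‖ - M₀) (‖g z₀ - v‖ - M₁)) :=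
      lt_min (lt_min hδ₀ hδ₁) (lt_min (sub_pos.2 hM₀) (sub_pos.2 hM₁))
    obtain ⟨δ, h1, h2⟩ := exists_between this
    simp only [lt_min_iff] at h2
    exact ⟨δ, h1, h2.1.1, h2.1.2, h2.2.1, h2.2.2⟩
  -- A product of one-variable bumps suits both the coordinatewise exchange and the sup norm of `ℝ ×
  -- ℝ`.
  let A : ContDiffBump v.1 := ⟨δ / 2, δ, half_pos hδ, half_lt_self hδ⟩
  let B : ContDiffBump v.2 := ⟨δ / 2, δ, half_pos hδ, half_lt_self hδ⟩
  let α : ℝ → ℝ := A.normed volume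
  let β : ℝ → ℝ := B.normed volume
  have hα : ContDiff ℝ 1 α := A.contDiff_normed (n := 1)
  have hβ : ContDiff ℝ 1 β := B.contDiff_normed (n := 1)
  have hαs : ∀ t, δ ≤ |t - v.1| → α t = 0 := fun t ht => by
    have : t ∉ support α := by
      rw [A.support_normed_eq, Metric.mem_ball, Real.dist_eq]
      exact not_lt.2 ht
    simpa using this
  have hβs : ∀ t, δ ≤ |t - v.2| → β t = 0 := fun t ht => by
    have : t ∉ support β := by
      rw [B.support_normed_eq, Metric.mem_ball, Real.dist_eq]
      exact not_lt.2 ht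
    simpa using this
  let ω : ℝ × ℝ → ℝ := fun y => α y.1 * β y.2
  have hω : Continuous ω := by
    have := hα.continuous
    have := hβ.continuous
    fun_prop
  have hωs : ∀ y, δ ≤ dist y v → ω y = 0 := fun y hy => by
    rw [Prod.dist_eq, le_max_iff, Real.dist_eq, Real.dist_eq] at hy
    rcases hy with hy | hy
    · simp [ω, hαs _ hy]
    · simp [ω, hβs _ hy]
  have hω1 : ∫ y, ω y = 1 := by
    have : ∫ y : ℝ × ℝ, ω y = (∫ t, α t) * ∫ t, β t := integral_prod_mul α β
    rw [this, A.integral_normed, B.integral_normed, mul_one]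
  have e₀ := hI₀ ω hω (fun y hy => hωs y (hδlt.1.le.trans hy)) hω1
  have e₁ := hI₁ ω hω (fun y hy => hωs y (hδlt.2.1.le.trans hy)) hω1
  have d₀ := H₀.smooth.differentiable (by simp)
  have d₁ := H₁.smooth.differentiable (by simp)
  simp only [det_fderiv_eq_planeJacobian (d₀ _)] at e₀
  simp only [det_fderiv_eq_planeJacobian (d₁ _)] at e₁
  have s₀ : ContDiff ℝ 2 h₀ := contDiff_infty.1 H₀.smooth 2
  have s₁ : ContDiff ℝ 2 h₁ := contDiff_infty.1 H₁.smooth 2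
  have hfar : ∀ x ∈ frontier U, ∀ w : ℝ × ℝ, ‖w - g x‖ ≤ max M₀ M₁ →
      δ < |w.1 - v.1| ∨ δ < |w.2 - v.2| := by
    intro x hx w hw
    have h1 : ‖g z₀ - v‖ ≤ ‖g x - v‖ := hmin hx
    have h2 : ‖g x - v‖ ≤ ‖w - g x‖ + ‖w - v‖ := by
      rw [← norm_neg (w - g x)]
      refine le_trans (le_of_eq ?_) (norm_add_le _ _)
      congr 1
      abel
    have h3 : δ < ‖w - v‖ := by
      rcases le_max_iff.1 hw with h | h
      · linarith [hδlt.2.2.1]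
      · linarith [hδlt.2.2.2]
    rwa [Prod.norm_def, lt_max_iff] at h3
  have hseg {s t c r M : ℝ} (hs : |s - c| ≤ M) (ht : |t - c| ≤ M) (hr : r ∈ uIcc s t) :
      |r - c| ≤ M := by
    have hc : Convex ℝ (Metric.closedBall c M) := convex_closedBall c M
    have := hc.ordConnected.uIcc_subset (Metric.mem_closedBall.2 hs) (Metric.mem_closedBall.2 ht) hr
    exact Metric.mem_closedBall.1 this
  have hcl₀ (x : ℝ × ℝ) (hx : x ∈ frontier U) : |(h₀ x).1 - (g x).1| ≤ max M₀ M₁ ∧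
      |(h₀ x).2 - (g x).2| ≤ max M₀ M₁ := by
    have := (hM₀' x (frontier_subset_closure hx)).trans (le_max_left M₀ M₁)
    exact max_le_iff.1 this
  have hcl₁ (x : ℝ × ℝ) (hx : x ∈ frontier U) : |(h₁ x).1 - (g x).1| ≤ max M₀ M₁ ∧
      |(h₁ x).2 - (g x).2| ≤ max M₀ M₁ := by
    have := (hM₁' x (frontier_subset_closure hx)).trans (le_max_right M₀ M₁)
    exact max_le_iff.1 this
  have step₁ := setIntegral_pullback_congr_fst hUo hUb s₀.fst s₁.fst s₀.snd hδ hα.continuous hβ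
    (fun t ht => hαs t ht.le) (fun t ht => hβs t ht.le) fun x hx t ht =>
      hfar x hx (t, (h₀ x).2) (max_le (hseg (hcl₀ x hx).1 (hcl₁ x hx).1 ht) (hcl₀ x hx).2)
  have step₂ := setIntegral_pullback_congr_fst hUo hUb s₀.snd s₁.snd s₁.fst hδ hβ.continuous hα
    (fun t ht => hβs t ht.le) (fun t ht => hαs t ht.le) fun x hx t ht =>
      (hfar x hx ((h₁ x).1, t)
        (max_le (hcl₁ x hx).1 (hseg (hcl₀ x hx).2 (hcl₁ x hx).2 ht))).symm
  simp only [planeJacobian_swap (fun y => (h₁ y).1), mul_neg, integral_neg, neg_inj] at step₂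
  have : (signedCount h₀ U v : ℝ) = signedCount h₁ U v := by
    rw [← e₀, ← e₁]
    simp only [ω]
    rw [step₁]
    simpa only [mul_comm, mul_left_comm, mul_assoc] using step₂
  exact_mod_cast this

theorem brouwerDegree_eq_signedCount {g h : ℝ × ℝ → ℝ × ℝ} {U : Set (ℝ × ℝ)} {v : ℝ × ℝ}
    (hUo : IsOpen U) (hUb : Bornology.IsBounded U) (hg : ContinuousOn g (closure U))
    (H : IsRegularApprox g U v h) : brouwerDegree g U v = signedCount h U v := by
  have hex : ∃ h, IsRegularApprox g U v h := ⟨h, H⟩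
  rw [brouwerDegree, dif_pos hex]
  exact hex.choose_spec.signedCount_eq hUo hUb hg H

/-! ### Continuous extension and smooth regular approximation -/

theorem exists_continuous_extension {g : ℝ × ℝ → ℝ × ℝ} {K : Set (ℝ × ℝ)} (hK : IsClosed K)
    (hg : ContinuousOn g K) : ∃ g' : ℝ × ℝ → ℝ × ℝ, Continuous g' ∧ EqOn g' g K := by
  obtain ⟨G, hG⟩ := ContinuousMap.exists_restrict_eq hK ⟨K.domRestrict g, hg.domRestrict⟩
  exact ⟨G, G.continuous, fun x hx => congrArg (fun f => f ⟨x, hx⟩) hG⟩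

open MeasureTheory in
/-- Smooth maps for which finitely many prescribed values are regular are dense. -/
theorem exists_smooth_regular_approx {g : ℝ × ℝ → ℝ × ℝ} {K : Set (ℝ × ℝ)} (hK : IsClosed K)
    (hg : ContinuousOn g K) {ε : ℝ} (hε : 0 < ε) {V : Set (ℝ × ℝ)} (hV : V.Countable) :
    ∃ h : ℝ × ℝ → ℝ × ℝ, ContDiff ℝ (⊤ : ℕ∞) h ∧ (∀ x ∈ K, ‖h x - g x‖ < ε) ∧
      ∀ v ∈ V, ∀ x, h x = v → (fderiv ℝ h x).det ≠ 0 := by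
  obtain ⟨g', hg', hgg'⟩ := exists_continuous_extension hK hg
  obtain ⟨f, hf, hfg, -⟩ := hg'.exists_contDiff_approx ⊤ (ε := fun _ => ε / 2)
    continuous_const fun _ => half_pos hε
  -- The critical values form a null set (Sard). The value `v` is critical for `f - c` only if `v +
  -- c ∈ C`, so a small `c` outside countably many null sets makes all of `V` regular at once.
  let C : Set (ℝ × ℝ) := f '' {x | (fderiv ℝ f x).det = 0}
  have hC : volume C = 0 := addHaar_image_eq_zero_of_det_fderivWithin_eq_zero volume
    (fun x _ => (hf.differentiable (by simp) x).hasFDerivAt.hasFDerivWithinAt) fun x hx => hx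
  have hC' : volume (⋃ v ∈ V, (fun c => v + c) ⁻¹' C) = 0 := by
    rw [measure_biUnion_null_iff hV]
    intro v _
    rw [measure_preimage_add]
    exact hC
  obtain ⟨c, hc, hcC⟩ : ∃ c ∈ Metric.ball (0 : ℝ × ℝ) (ε / 2), c ∉ ⋃ v ∈ V, (fun c => v + c) ⁻¹' C := by
    by_contra! hcon
    have := measure_mono_null hcon hC'
    exact (Metric.measure_ball_pos volume _ (half_pos hε)).ne' this
  refine ⟨fun x => f x - c, hf.sub contDiff_const, fun x hx => ?_, fun v hv x hx => ?_⟩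
  · have h1 := hfg x
    rw [hgg' hx, dist_eq_norm] at h1
    have h2 : ‖c‖ < ε / 2 := by simpa using hc
    calc ‖f x - c - g x‖ = ‖f x - g x - c‖ := by congr 1; abel
      _ ≤ ‖f x - g x‖ + ‖c‖ := norm_sub_le _ _
      _ < ε := by linarith
  · rw [fderiv_sub_const]
    intro h0
    refine hcC (mem_biUnion hv ⟨x, h0, ?_⟩)
    rw [← hx]
    simp

theorem exists_pos_le_norm_sub {X : Type*} [TopologicalSpace X] {K : Set X} (hK : IsCompact K)
    {f : X → ℝ × ℝ} (hf : ContinuousOn f K) {v : ℝ × ℝ} (hv : ∀ x ∈ K, f x ≠ v) :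
    ∃ m > 0, ∀ x ∈ K, m ≤ ‖f x - v‖ := by
  rcases K.eq_empty_or_nonempty with rfl | hne
  · exact ⟨1, one_pos, by simp⟩
  · obtain ⟨x₀, hx₀, hmin⟩ := hK.exists_isMinOn hne (hf.sub continuousOn_const).norm
    exact ⟨_, norm_pos_iff.2 (sub_ne_zero.2 (hv x₀ hx₀)), fun x hx => hmin hx⟩

theorem isCompact_frontier_of_isBounded {U : Set (ℝ × ℝ)} (hUb : Bornology.IsBounded U) :
    IsCompact (frontier U) :=
  hUb.isCompact_closure.of_isClosed_subset isClosed_frontier frontier_subset_closure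

/-! ## Properties of the Brouwer degree -/

/-- The predicates defining admissible approximations are equal, hence so are the choices made from
them; no continuity is needed. -/
theorem brouwerDegree_congr {g g' : ℝ × ℝ → ℝ × ℝ} {U : Set (ℝ × ℝ)} {v : ℝ × ℝ}
    (h : EqOn g g' (closure U)) : brouwerDegree g U v = brouwerDegree g' U v := by
  classical
  have key : IsRegularApprox g U v = IsRegularApprox g' U v := by
    have aux {g g' : ℝ × ℝ → ℝ × ℝ} (h : EqOn g g' (closure U)) (f : ℝ × ℝ → ℝ × ℝ)
        (H : IsRegularApprox g U v f) : IsRegularApprox g' U v f :=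
      ⟨H.smooth, fun x hx z hz => by
        rw [← h hx, ← h (frontier_subset_closure hz)]; exact H.close x hx z hz, H.regular⟩
    funext f
    exact propext ⟨aux h f, aux h.symm f⟩
  unfold brouwerDegree
  rw [key]

theorem exists_isRegularApprox {g : ℝ × ℝ → ℝ × ℝ} {U : Set (ℝ × ℝ)} {v : ℝ × ℝ}
    (hg : ContinuousOn g (closure U)) {m : ℝ} (hm : 0 < m)
    (hfr : ∀ z ∈ frontier U, m ≤ ‖g z - v‖) :
    ∃ h, IsRegularApprox g U v h ∧ (∀ x ∈ closure U, ‖h x - g x‖ < m) := by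
  obtain ⟨h, h1, h2, h3⟩ := exists_smooth_regular_approx isClosed_closure hg hm
    (countable_singleton v)
  exact ⟨h, ⟨h1, fun x hx z hz => (h2 x hx).trans_le (hfr z hz),
    fun x _ => h3 v rfl x⟩, h2⟩

/-- An approximation within `m / 2` of `g₀` is within `m` of `g₁`, so a single smooth map computes
both degrees. -/
theorem brouwerDegree_eq_of_norm_sub_lt {g₀ g₁ : ℝ × ℝ → ℝ × ℝ} {U : Set (ℝ × ℝ)} {v : ℝ × ℝ}
    (hUo : IsOpen U) (hUb : Bornology.IsBounded U) (hg₀ : ContinuousOn g₀ (closure U))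
    (hg₁ : ContinuousOn g₁ (closure U)) {m : ℝ} (hm : 0 < m)
    (h₀ : ∀ z ∈ frontier U, m ≤ ‖g₀ z - v‖) (h₁ : ∀ z ∈ frontier U, m ≤ ‖g₁ z - v‖)
    (hclose : ∀ x ∈ closure U, ‖g₀ x - g₁ x‖ < m / 2) :
    brouwerDegree g₀ U v = brouwerDegree g₁ U v := by
  obtain ⟨h, hh, hlt⟩ := exists_isRegularApprox hg₀ (half_pos hm)
    fun z hz => (half_le_self hm.le).trans (h₀ z hz)
  have hh' : IsRegularApprox g₁ U v h := ⟨hh.smooth, fun x hx z hz => by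
    calc ‖h x - g₁ x‖ ≤ ‖h x - g₀ x‖ + ‖g₀ x - g₁ x‖ := norm_sub_le_norm_sub_add_norm_sub _ _ _
      _ < m := by linarith [hlt x hx, hclose x hx]
      _ ≤ _ := h₁ z hz, hh.regular⟩
  rw [brouwerDegree_eq_signedCount hUo hUb hg₀ hh, brouwerDegree_eq_signedCount hUo hUb hg₁ hh']

/-- Homotopy invariance of the Brouwer degree. -/
theorem brouwerDegree_homotopy {H : ℝ → ℝ × ℝ → ℝ × ℝ} {U : Set (ℝ × ℝ)} {v : ℝ × ℝ}
    (hUo : IsOpen U) (hUb : Bornology.IsBounded U)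
    (hH : ContinuousOn (uncurry H) (Icc 0 1 ×ˢ closure U))
    (hne : ∀ s ∈ Icc (0 : ℝ) 1, ∀ x ∈ frontier U, H s x ≠ v) :
    brouwerDegree (H 0) U v = brouwerDegree (H 1) U v := by
  have hfr : Icc (0 : ℝ) 1 ×ˢ frontier U ⊆ Icc 0 1 ×ˢ closure U :=
    prod_mono_right frontier_subset_closure
  obtain ⟨m, hm, hmle⟩ := exists_pos_le_norm_sub
    (isCompact_Icc.prod (isCompact_frontier_of_isBounded hUb)) (hH.mono hfr)
    (v := v) fun p hp => hne p.1 hp.1 p.2 hp.2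
  have huc := (isCompact_Icc.prod hUb.isCompact_closure).uniformContinuousOn_of_continuous hH
  obtain ⟨δ, hδ, hδ'⟩ := Metric.uniformContinuousOn_iff.1 huc (m / 2) (half_pos hm)
  have hcont (s : ℝ) (hs : s ∈ Icc (0 : ℝ) 1) : ContinuousOn (H s) (closure U) :=
    hH.comp (continuousOn_const.prodMk continuousOn_id) fun x hx => ⟨hs, hx⟩
  -- The degree is locally constant in `s` by uniform continuity of `H`, hence constant on the
  -- connected interval.
  have hd : ContinuousOn (fun s => brouwerDegree (H s) U v) (Icc 0 1) := fun s hs => by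
    refine (continuousWithinAt_const (b := brouwerDegree (H s) U v)).congr_of_eventuallyEq ?_ rfl
    filter_upwards [inter_mem_nhdsWithin (Icc 0 1) (Metric.ball_mem_nhds s hδ)] with t ht
    refine brouwerDegree_eq_of_norm_sub_lt hUo hUb (hcont t ht.1) (hcont s hs) hm
      (fun z hz => hmle (t, z) ⟨ht.1, hz⟩) (fun z hz => hmle (s, z) ⟨hs, hz⟩) fun x hx => ?_
    rw [← dist_eq_norm]
    refine hδ' (t, x) ⟨ht.1, hx⟩ (s, x) ⟨hs, hx⟩ ?_
    rw [Prod.dist_eq, dist_self]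
    exact max_lt ht.2 hδ
  exact isPreconnected_Icc.constant hd (left_mem_Icc.2 zero_le_one) (right_mem_Icc.2 zero_le_one)

theorem brouwerDegree_eq_of_segment {g₀ g₁ : ℝ × ℝ → ℝ × ℝ} {U : Set (ℝ × ℝ)} {v : ℝ × ℝ}
    (hUo : IsOpen U) (hUb : Bornology.IsBounded U) (hg₀ : ContinuousOn g₀ (closure U))
    (hg₁ : ContinuousOn g₁ (closure U))
    (hne : ∀ s ∈ Icc (0 : ℝ) 1, ∀ x ∈ frontier U, g₀ x + s • (g₁ x - g₀ x) ≠ v) :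
    brouwerDegree g₀ U v = brouwerDegree g₁ U v := by
  have h0 : ContinuousOn (fun p : ℝ × (ℝ × ℝ) => g₀ p.2) (Icc 0 1 ×ˢ closure U) :=
    hg₀.comp continuousOn_snd fun p hp => hp.2
  have h1 : ContinuousOn (fun p : ℝ × (ℝ × ℝ) => g₁ p.2) (Icc 0 1 ×ˢ closure U) :=
    hg₁.comp continuousOn_snd fun p hp => hp.2
  have := brouwerDegree_homotopy (H := fun s x => g₀ x + s • (g₁ x - g₀ x)) hUo hUb
    (h0.add (continuousOn_fst.smul (h1.sub h0))) hne
  simpa using this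

theorem brouwerDegree_eq_of_eqOn_frontier {g₀ g₁ : ℝ × ℝ → ℝ × ℝ} {U : Set (ℝ × ℝ)} {v : ℝ × ℝ}
    (hUo : IsOpen U) (hUb : Bornology.IsBounded U) (hg₀ : ContinuousOn g₀ (closure U))
    (hg₁ : ContinuousOn g₁ (closure U)) (heq : EqOn g₀ g₁ (frontier U))
    (hne : ∀ x ∈ frontier U, g₀ x ≠ v) :
    brouwerDegree g₀ U v = brouwerDegree g₁ U v :=
  brouwerDegree_eq_of_segment hUo hUb hg₀ hg₁ fun s _ x hx => by
    rw [← heq hx, sub_self, smul_zero, add_zero]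
    exact hne x hx

/-- Additivity of the Brouwer degree. -/
theorem brouwerDegree_eq_sum {ι : Type*} {g : ℝ × ℝ → ℝ × ℝ} {U : Set (ℝ × ℝ)} {v : ℝ × ℝ}
    (hUo : IsOpen U) (hUb : Bornology.IsBounded U) (hg : ContinuousOn g (closure U))
    (I : Finset ι) (V : ι → Set (ℝ × ℝ)) (hVo : ∀ i ∈ I, IsOpen (V i)) (hVU : ∀ i ∈ I, V i ⊆ U)
    (hdisj : (I : Set ι).PairwiseDisjoint V) (hne : ∀ x ∈ closure U \ ⋃ i ∈ I, V i, g x ≠ v) :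
    brouwerDegree g U v = ∑ i ∈ I, brouwerDegree g (V i) v := by
  -- The compact set `closure U \ ⋃ V i` contains the frontiers of `U` and of every `V i`. An
  -- approximation within `m` is thus admissible for all these sets and has no preimage of `v` in
  -- `U` outside the `V i`.
  obtain ⟨m, hm, hmle⟩ := exists_pos_le_norm_sub
    (hUb.isCompact_closure.diff (isOpen_biUnion hVo)) (hg.mono sdiff_subset) hne
  have hUfr : frontier U ⊆ closure U \ ⋃ i ∈ I, V i := fun x hx =>
    ⟨frontier_subset_closure hx, fun h => by
      obtain ⟨i, hi, hxi⟩ := mem_iUnion₂.1 h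
      rw [hUo.frontier_eq] at hx
      exact hx.2 (hVU i hi hxi)⟩
  have hVfr (i : ι) (hi : i ∈ I) : frontier (V i) ⊆ closure U \ ⋃ i ∈ I, V i := fun x hx =>
    ⟨closure_mono (hVU i hi) (frontier_subset_closure hx), fun h => by
      obtain ⟨j, hj, hxj⟩ := mem_iUnion₂.1 h
      by_cases hij : i = j
      · subst hij
        rw [(hVo i hi).frontier_eq] at hx
        exact hx.2 hxj
      · exact disjoint_left.1 ((hdisj hi hj hij).closure_left (hVo j hj))
          (frontier_subset_closure hx) hxj⟩
  obtain ⟨h, hh, hlt⟩ := exists_isRegularApprox hg hm fun z hz => hmle z (hUfr hz)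
  have hhV (i : ι) (hi : i ∈ I) : IsRegularApprox g (V i) v h :=
    ⟨hh.smooth, fun x hx z hz => (hlt x (closure_mono (hVU i hi) hx)).trans_le
      (hmle z (hVfr i hi hz)), fun x hx => hh.regular x (hVU i hi hx)⟩
  rw [brouwerDegree_eq_signedCount hUo hUb hg hh, Finset.sum_congr rfl fun i hi =>
    brouwerDegree_eq_signedCount (hVo i hi) (hUb.subset (hVU i hi))
      (hg.mono (closure_mono (hVU i hi))) (hhV i hi)]
  have hset : {x | x ∈ U ∧ h x = v} = ⋃ i ∈ (I : Set ι), {x | x ∈ V i ∧ h x = v} := by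
    ext x
    rw [mem_iUnion₂]
    constructor
    · rintro ⟨hx, hxv⟩
      by_cases hxV : x ∈ ⋃ i ∈ I, V i
      · obtain ⟨i, hi, hxi⟩ := mem_iUnion₂.1 hxV
        exact ⟨i, hi, hxi, hxv⟩
      · have h1 := hlt x (subset_closure hx)
        have h2 := hmle x ⟨subset_closure hx, hxV⟩
        rw [hxv, norm_sub_rev] at h1
        exact absurd h1 (not_lt.2 h2)
    · rintro ⟨i, hi, hxi, hxv⟩
      exact ⟨hVU i hi hxi, hxv⟩
  have hfin := finite_preimage_of_regular hh.smooth hUb hh.ne_of_mem_frontier hh.regular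
  simp only [signedCount]
  rw [hset, finsum_mem_biUnion, finsum_mem_coe_finset]
  · exact fun i hi j hj hij => (hdisj hi hj hij).mono (fun x hx => hx.1) fun x hx => hx.1
  · exact I.finite_toSet
  · exact fun i hi => hfin.subset fun x hx => ⟨hVU i hi hx.1, hx.2⟩

theorem brouwerDegree_excision {g : ℝ × ℝ → ℝ × ℝ} {U V : Set (ℝ × ℝ)} {v : ℝ × ℝ}
    (hUo : IsOpen U) (hUb : Bornology.IsBounded U) (hg : ContinuousOn g (closure U))
    (hVo : IsOpen V) (hVU : V ⊆ U) (hne : ∀ x ∈ closure U \ V, g x ≠ v) :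
    brouwerDegree g U v = brouwerDegree g V v := by
  have := brouwerDegree_eq_sum hUo hUb hg (Finset.univ : Finset Unit) (fun _ => V)
    (fun _ _ => hVo) (fun _ _ => hVU) (by simp [Set.PairwiseDisjoint, Set.Pairwise])
    (by simpa using hne)
  simpa using this

/-- This is additivity over the empty family. -/
theorem brouwerDegree_eq_zero {g : ℝ × ℝ → ℝ × ℝ} {U : Set (ℝ × ℝ)} {v : ℝ × ℝ}
    (hUo : IsOpen U) (hUb : Bornology.IsBounded U) (hg : ContinuousOn g (closure U))
    (hne : ∀ x ∈ closure U, g x ≠ v) : brouwerDegree g U v = 0 := by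
  have := brouwerDegree_eq_sum hUo hUb hg (∅ : Finset Unit) (fun _ => ∅) (by simp) (by simp)
    (by simp) (by simpa using hne)
  simpa using this

/-- There are finitely many zeros, so one radius `ε` serves all of them and additivity applies to
disjoint balls. -/
theorem brouwerDegree_eq_sum_local {g : ℝ × ℝ → ℝ × ℝ} {U : Set (ℝ × ℝ)} {v : ℝ × ℝ}
    (hUo : IsOpen U) (hUb : Bornology.IsBounded U) (hg : ContinuousOn g (closure U))
    (Z : Finset (ℝ × ℝ)) (hZU : ∀ z ∈ Z, z ∈ U) (hZ : ∀ x ∈ closure U, g x = v → x ∈ Z)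
    (d : ℝ × ℝ → ℤ)
    (hd : ∀ z ∈ Z, ∀ᶠ ε in 𝓝[>] (0 : ℝ), brouwerDegree g (Metric.ball z ε) v = d z) :
    brouwerDegree g U v = ∑ z ∈ Z, d z := by
  obtain ⟨D, hD, hDdisj⟩ := Z.finite_toSet.t2_separation
  have h1 : ∀ᶠ ε in 𝓝[>] (0 : ℝ), ∀ z ∈ Z, brouwerDegree g (Metric.ball z ε) v = d z ∧
      Metric.ball z ε ⊆ U ∩ D z := by
    rw [Filter.eventually_all_finset]
    intro z hz
    obtain ⟨ε, hε, hεs⟩ := Metric.mem_nhds_iff.1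
      (Filter.inter_mem (hUo.mem_nhds (hZU z hz)) ((hD z).2.mem_nhds (hD z).1))
    filter_upwards [Ioo_mem_nhdsGT hε, hd z hz] with δ hδ hδ'
    exact ⟨hδ', (Metric.ball_subset_ball hδ.2.le).trans hεs⟩
  obtain ⟨ε, hε, hε0⟩ := (h1.and self_mem_nhdsWithin).exists
  rw [brouwerDegree_eq_sum hUo hUb hg Z (fun z => Metric.ball z ε) (fun _ _ => Metric.isOpen_ball)
    (fun z hz => (hε z hz).2.trans inter_subset_left)
    (fun z hz w hw hzw => (hDdisj hz hw hzw).mono ((hε z hz).2.trans inter_subset_right)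
      ((hε w hw).2.trans inter_subset_right))]
  · exact Finset.sum_congr rfl fun z hz => (hε z hz).1
  · intro x hx hxv
    have hxZ := hZ x hx.1 hxv
    exact hx.2 (mem_biUnion hxZ (Metric.mem_ball_self hε0))

theorem brouwerDegree_of_regular {g : ℝ × ℝ → ℝ × ℝ} {U : Set (ℝ × ℝ)} {v : ℝ × ℝ}
    (hUo : IsOpen U) (hUb : Bornology.IsBounded U) (hg : ContDiff ℝ (⊤ : ℕ∞) g)
    (hne : ∀ x ∈ frontier U, g x ≠ v) (hreg : ∀ x ∈ U, g x = v → (fderiv ℝ g x).det ≠ 0) :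
    brouwerDegree g U v = signedCount g U v :=
  brouwerDegree_eq_signedCount hUo hUb hg.continuous.continuousOn ⟨hg, fun x _ z hz => by
    rw [sub_self, norm_zero]
    exact norm_pos_iff.2 (sub_ne_zero.2 (hne z hz)), hreg⟩

theorem brouwerDegree_sub_const {g : ℝ × ℝ → ℝ × ℝ} {U : Set (ℝ × ℝ)} {c : ℝ × ℝ}
    (hUo : IsOpen U) (hUb : Bornology.IsBounded U) (hg : ContinuousOn g (closure U))
    (hne : ∀ x ∈ frontier U, g x ≠ c) :
    brouwerDegree (fun x => g x - c) U 0 = brouwerDegree g U c := by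
  obtain ⟨m, hm, hmle⟩ := exists_pos_le_norm_sub (isCompact_frontier_of_isBounded hUb)
    (hg.mono frontier_subset_closure) hne
  obtain ⟨h, hh, -⟩ := exists_isRegularApprox hg hm hmle
  have hh' : IsRegularApprox (fun x => g x - c) U 0 fun x => h x - c :=
    ⟨hh.smooth.sub contDiff_const, fun x hx z hz => by
      simpa using hh.close x hx z hz, fun x hx hxc => by
      rw [fderiv_sub_const]
      exact hh.regular x hx (sub_eq_zero.1 hxc)⟩
  rw [brouwerDegree_eq_signedCount hUo hUb (g := fun x => g x - c)
    (hg.sub continuousOn_const) hh',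
    brouwerDegree_eq_signedCount hUo hUb hg hh]
  simp only [signedCount, fderiv_sub_const, sub_eq_zero]

theorem isOpen_image_of_det_ne_zero {k : ℝ × ℝ → ℝ × ℝ} (hk : ContDiff ℝ (⊤ : ℕ∞) k)
    {B : Set (ℝ × ℝ)} (hBo : IsOpen B) (hdet : ∀ x ∈ B, (fderiv ℝ k x).det ≠ 0) :
    IsOpen (k '' B) := isOpen_iff_mem_nhds.2 fun y hy => by
  obtain ⟨x, hx, rfl⟩ := hy
  obtain ⟨N, hN, -, -, -, hN', -⟩ := exists_injOn_sign_const hk (hdet x hx) (hBo.mem_nhds hx)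
  exact Filter.mem_of_superset hN' (image_mono hN)

/-- The degree of a composition with an injective local diffeomorphism. -/
theorem brouwerDegree_comp {g k : ℝ × ℝ → ℝ × ℝ} {B : Set (ℝ × ℝ)} {v : ℝ × ℝ} {s : SignType}
    (hBo : IsOpen B) (hBb : Bornology.IsBounded B) (hk : ContDiff ℝ (⊤ : ℕ∞) k)
    (hinj : InjOn k (closure B)) (hs : s ≠ 0) (hsign : ∀ x ∈ B, SignType.sign (fderiv ℝ k x).det = s)
    (hg : ContinuousOn g (k '' closure B)) (hne : ∀ x ∈ frontier B, g (k x) ≠ v) :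
    brouwerDegree (g ∘ k) B v = s * brouwerDegree g (k '' B) v := by
  have hdet : ∀ x ∈ B, (fderiv ℝ k x).det ≠ 0 := fun x hx h0 => hs (by
    rw [← hsign x hx, h0, sign_zero])
  have hopen : IsOpen (k '' B) := isOpen_image_of_det_ne_zero hk hBo hdet
  have hcl : closure (k '' B) = k '' closure B :=
    (image_closure_of_isCompact hBb.isCompact_closure hk.continuous.continuousOn).symm
  -- Injectivity up to the closure is what makes `k` carry frontier to frontier, so that `h ∘ k`
  -- inherits admissibility from `h`.
  have hfr : frontier (k '' B) = k '' frontier B := by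
    rw [hopen.frontier_eq, hcl, hBo.frontier_eq, hinj.image_sdiff_subset subset_closure]
  have hbdd : Bornology.IsBounded (k '' B) :=
    (hBb.isCompact_closure.image hk.continuous).isBounded.subset (image_mono subset_closure)
  rw [← hcl] at hg
  obtain ⟨m, hm, hmle⟩ := exists_pos_le_norm_sub (isCompact_frontier_of_isBounded hbdd)
    (hg.mono frontier_subset_closure) (v := v) (by
      rw [hfr]; rintro _ ⟨x, hx, rfl⟩; exact hne x hx)
  obtain ⟨h, hh, -⟩ := exists_isRegularApprox hg hm hmle
  have hfd (x : ℝ × ℝ) : (fderiv ℝ (h ∘ k) x).det =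
      (fderiv ℝ h (k x)).det * (fderiv ℝ k x).det := by
    rw [fderiv_comp x (hh.smooth.differentiable (by simp) _) (hk.differentiable (by simp) _)]
    exact LinearMap.det_comp _ _
  have hh' : IsRegularApprox (g ∘ k) B v (h ∘ k) := ⟨hh.smooth.comp hk, fun x hx z hz =>
    hh.close (k x) (hcl ▸ mem_image_of_mem k hx) (k z) (hfr ▸ mem_image_of_mem k hz),
    fun x hx hxv => by
      rw [hfd]
      exact mul_ne_zero (hh.regular (k x) (mem_image_of_mem k hx) hxv) (hdet x hx)⟩
  rw [brouwerDegree_eq_signedCount hBo hBb (hg.comp hk.continuous.continuousOn fun x hx =>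
    hcl ▸ mem_image_of_mem k hx) hh', brouwerDegree_eq_signedCount hopen hbdd hg hh]
  have hset : {y | y ∈ k '' B ∧ h y = v} = k '' {x | x ∈ B ∧ (h ∘ k) x = v} := by
    ext y
    constructor
    · rintro ⟨⟨x, hx, rfl⟩, hxv⟩
      exact ⟨x, ⟨hx, hxv⟩, rfl⟩
    · rintro ⟨x, ⟨hx, hxv⟩, rfl⟩
      exact ⟨⟨x, hx, rfl⟩, hxv⟩
  have hinj' : InjOn k {x | x ∈ B ∧ (h ∘ k) x = v} := hinj.mono fun x hx => subset_closure hx.1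
  rw [signedCount, signedCount, hset, finsum_mem_image hinj', mul_finsum_mem]
  refine finsum_mem_congr rfl fun x hx => ?_
  rw [hfd, sign_mul, hsign x hx.1, SignType.coe_mul, mul_comm]

/-! ## Topology of polar-like coordinates -/

/-- The radial map `x ↦ ρ x / (1 + ‖x‖)`, with inverse `y ↦ y / (ρ - ‖y‖)`, carries the connected
punctured plane onto the punctured ball. -/
theorem isPreconnected_ball_diff_center {ρ : ℝ} (hρ : 0 < ρ) :
    IsPreconnected (Metric.ball (0 : ℝ × ℝ) ρ \ {0}) := by
  have hc : IsPreconnected ({0}ᶜ : Set (ℝ × ℝ)) :=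
    (isConnected_compl_singleton_of_one_lt_rank (by simp [one_add_one_eq_two]) 0).isPreconnected
  have hpos (x : ℝ × ℝ) : 0 < 1 + ‖x‖ := by positivity
  have hcont : Continuous fun x : ℝ × ℝ => (ρ / (1 + ‖x‖)) • x :=
    (continuous_const.div (by fun_prop) fun x => (hpos x).ne').smul continuous_id
  convert! hc.image _ hcont.continuousOn using 1
  ext y
  simp only [Metric.mem_ball, dist_zero_right, mem_sdiff, mem_singleton_iff, mem_image,
    mem_compl_iff]
  constructor
  · rintro ⟨hy, hy0⟩
    have h1 : 0 < ρ - ‖y‖ := sub_pos.2 hy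
    refine ⟨(1 / (ρ - ‖y‖)) • y, by simp [h1.ne', hy0], ?_⟩
    rw [norm_smul, smul_smul, Real.norm_of_nonneg (by positivity)]
    convert one_smul ℝ y using 2
    field_simp
    ring
  · rintro ⟨x, hx, rfl⟩
    have hp : 0 < ρ / (1 + ‖x‖) := div_pos hρ (hpos x)
    refine ⟨?_, by simp [hp.ne', hx]⟩
    rw [norm_smul, Real.norm_of_nonneg hp.le, div_mul_eq_mul_div, div_lt_iff₀ (hpos x)]
    nlinarith

theorem rotationValue_add (j k : ℤ) :
    rotationValue (j + k) = rotationValue j + rotationValue k := by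
  simp [rotationValue, mul_add]

theorem rotationValue_neg (k : ℤ) : rotationValue (-k) = -rotationValue k := by
  simp [rotationValue]

theorem rotationValue_zero : rotationValue 0 = 0 := by
  simp [rotationValue]

theorem rotationValue_injective : Injective rotationValue := fun j k h => by
  have := congrArg Prod.fst h
  simpa [rotationValue, Real.pi_ne_zero] using this

theorem add_rotationValue_snd (y : ℝ × ℝ) (k : ℤ) : (y + rotationValue k).2 = y.2 := by
  simp [rotationValue]

theorem exists_add_rotationValue_mem_Ico (y : ℝ × ℝ) :
    ∃ k : ℤ, (y + rotationValue k).1 ∈ Ico 0 (2 * Real.pi) := by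
  refine ⟨-toIcoDiv Real.two_pi_pos 0 y.1, ?_⟩
  have := sub_toIcoDiv_zsmul_mem_Ico Real.two_pi_pos 0 y.1
  rw [zsmul_eq_mul, zero_add] at this
  have he : (y + rotationValue (-toIcoDiv Real.two_pi_pos 0 y.1)).1 =
      y.1 - (toIcoDiv Real.two_pi_pos 0 y.1 : ℝ) * (2 * Real.pi) := by
    simp only [rotationValue, Prod.fst_add, Int.cast_neg]
    ring
  rwa [he]

theorem apply_add_rotationValue {F : ℝ × ℝ → ℝ × ℝ}
    (hF : ∀ θ r : ℝ, 0 ≤ r → F (θ + 2 * Real.pi, r) = F (θ, r)) {y : ℝ × ℝ} (hy : 0 ≤ y.2)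
    (k : ℤ) : F (y + rotationValue k) = F y := by
  have hnat (n : ℕ) (y : ℝ × ℝ) (hy : 0 ≤ y.2) : F (y + rotationValue n) = F y := by
    induction n with
    | zero => simp [rotationValue_zero]
    | succ n ih =>
      rw [← ih, ← hF (y + rotationValue n).1 _ (by rwa [add_rotationValue_snd])]
      congr 1
      ext <;> simp [rotationValue]
      ring
  obtain ⟨n, rfl | rfl⟩ := k.eq_nat_or_neg
  · exact hnat n y hy
  · rw [← hnat n _ (by rwa [add_rotationValue_snd]), rotationValue_neg, neg_add_cancel_right]

namespace IsPolarLike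

variable {Ψ : ℝ × ℝ → ℝ × ℝ}

theorem add_rotationValue (hΨ : IsPolarLike Ψ) {y : ℝ × ℝ} (hy : 0 ≤ y.2) (k : ℤ) :
    Ψ (y + rotationValue k) = Ψ y := apply_add_rotationValue hΨ.periodic hy k

theorem ne_zero (hΨ : IsPolarLike Ψ) {y : ℝ × ℝ} (hy : 0 < y.2) : Ψ y ≠ 0 := fun h =>
  hy.ne' ((hΨ.origin y hy.le).1 h)

theorem pos_of_ne_zero (hΨ : IsPolarLike Ψ) {y : ℝ × ℝ} (hy : 0 ≤ y.2) (h : Ψ y ≠ 0) :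
    0 < y.2 := lt_of_le_of_ne hy fun h0 => h ((hΨ.origin y hy).2 h0.symm)

/-- Both points are translated into the fundamental strip, where `Ψ` is injective. -/
theorem exists_eq_add_rotationValue (hΨ : IsPolarLike Ψ) {a b : ℝ × ℝ} (ha : 0 < a.2)
    (hb : 0 ≤ b.2) (h : Ψ a = Ψ b) : ∃ k : ℤ, b = a + rotationValue k := by
  have hb' : 0 < b.2 := hΨ.pos_of_ne_zero hb (h ▸ hΨ.ne_zero ha)
  obtain ⟨j, hj⟩ := exists_add_rotationValue_mem_Ico a
  obtain ⟨k, hk⟩ := exists_add_rotationValue_mem_Ico b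
  have hinj := hΨ.bijOn.injOn (x₁ := a + rotationValue j) (x₂ := b + rotationValue k)
    ⟨hj, by rw [mem_Ioi, add_rotationValue_snd]; exact ha⟩
    ⟨hk, by rw [mem_Ioi, add_rotationValue_snd]; exact hb'⟩
    (by rw [hΨ.add_rotationValue ha.le, hΨ.add_rotationValue hb, h])
  refine ⟨j + -k, ?_⟩
  rw [rotationValue_add, rotationValue_neg, ← add_assoc, hinj, add_neg_cancel_right]

theorem polarInv_mem (hΨ : IsPolarLike Ψ) (x : ℝ × ℝ) :
    polarInv Ψ x ∈ ({(0, 0)} ∪ Ico 0 (2 * Real.pi) ×ˢ Ioi 0 : Set (ℝ × ℝ)) ∧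
      Ψ (polarInv Ψ x) = x := by
  have hex : ∃ a ∈ ({(0, 0)} ∪ Ico 0 (2 * Real.pi) ×ˢ Ioi 0 : Set (ℝ × ℝ)), Ψ a = x := by
    by_cases hx : x = 0
    · exact ⟨(0, 0), Or.inl rfl, hx ▸ (hΨ.origin (0, 0) (le_refl (0 : ℝ))).2 rfl⟩
    · obtain ⟨a, ha, hax⟩ := hΨ.bijOn.surjOn hx
      exact ⟨a, Or.inr ha, hax⟩
  exact ⟨invFunOn_mem hex, invFunOn_eq hex⟩

theorem apply_polarInv (hΨ : IsPolarLike Ψ) (x : ℝ × ℝ) : Ψ (polarInv Ψ x) = x :=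
  (hΨ.polarInv_mem x).2

theorem polarInv_fst_mem (hΨ : IsPolarLike Ψ) (x : ℝ × ℝ) :
    (polarInv Ψ x).1 ∈ Icc 0 (2 * Real.pi) := by
  rcases (hΨ.polarInv_mem x).1 with h | h
  · rw [h]
    exact ⟨le_rfl, Real.two_pi_pos.le⟩
  · exact Ico_subset_Icc_self h.1

theorem polarInv_nonneg (hΨ : IsPolarLike Ψ) (x : ℝ × ℝ) : 0 ≤ (polarInv Ψ x).2 := by
  rcases (hΨ.polarInv_mem x).1 with h | h
  · rw [h]
  · exact le_of_lt h.2

theorem polarInv_pos (hΨ : IsPolarLike Ψ) {x : ℝ × ℝ} (hx : x ≠ 0) : 0 < (polarInv Ψ x).2 :=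
  hΨ.pos_of_ne_zero (hΨ.polarInv_nonneg x) (by rwa [hΨ.apply_polarInv])

theorem polarInv_zero (hΨ : IsPolarLike Ψ) : polarInv Ψ 0 = 0 := by
  rcases (hΨ.polarInv_mem 0).1 with h | h
  · exact h
  · exact absurd (hΨ.polarInv_mem 0).2 (hΨ.ne_zero h.2)

theorem polarInv_mem_polarPreimage (hΨ : IsPolarLike Ψ) {E : Set (ℝ × ℝ)} {x : ℝ × ℝ}
    (hx : x ∈ E) : polarInv Ψ x ∈ polarPreimage Ψ E :=
  ⟨hΨ.polarInv_nonneg x, by rwa [hΨ.apply_polarInv]⟩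

theorem exists_eq_polarInv_add (hΨ : IsPolarLike Ψ) {y : ℝ × ℝ} (hy : 0 < y.2) :
    ∃ k : ℤ, y = polarInv Ψ (Ψ y) + rotationValue k :=
  hΨ.exists_eq_add_rotationValue (hΨ.polarInv_pos (hΨ.ne_zero hy)) hy.le (hΨ.apply_polarInv _)

/-- `polarInv` may jump where the angle wraps around; local continuous branches replace it in
continuity arguments. -/
theorem exists_section (hΨ : IsPolarLike Ψ) {x₀ : ℝ × ℝ} (hx₀ : x₀ ≠ 0) :
    ∃ (σ : ℝ × ℝ → ℝ × ℝ) (O : Set (ℝ × ℝ)), IsOpen O ∧ x₀ ∈ O ∧ ContinuousOn σ O ∧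
      ∀ x ∈ O, 0 < (σ x).2 ∧ Ψ (σ x) = x := by
  have hy₀ := hΨ.polarInv_pos hx₀
  obtain ⟨e, he, hΨe⟩ := hΨ.localHomeo _ hy₀
  have hx₀' : e (polarInv Ψ x₀) = x₀ := by rw [← hΨe, hΨ.apply_polarInv]
  have hopen : IsOpen {y : ℝ × ℝ | 0 < y.2} := isOpen_lt continuous_const continuous_snd
  refine ⟨e.symm, e.target ∩ e.symm ⁻¹' {y | 0 < y.2}, e.symm.isOpen_inter_preimage hopen,
    ⟨hx₀' ▸ e.map_source he, ?_⟩, e.continuousOn_symm.mono inter_subset_left, fun x hx =>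
      ⟨hx.2, by rw [hΨe]; exact e.right_inv hx.1⟩⟩
  have : e.symm x₀ = polarInv Ψ x₀ := by rw [← hx₀', e.left_inv he, hx₀']
  rwa [mem_preimage, this]

/-- Functions which are periodic in the angle descend to continuous functions on the plane. -/
theorem continuousOn_comp_polarInv (hΨ : IsPolarLike Ψ) {Y : Type*} [TopologicalSpace Y]
    {E : Set (ℝ × ℝ)} (hE : 0 ∉ E) {F : ℝ × ℝ → Y} (hF : ContinuousOn F (polarPreimage Ψ E))
    (hper : ∀ y ∈ polarPreimage Ψ E, ∀ k : ℤ, F (y + rotationValue k) = F y) :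
    ContinuousOn (F ∘ polarInv Ψ) E := by
  intro x₀ hx₀
  obtain ⟨σ, O, hO, hx₀O, hσ, hσO⟩ := hΨ.exists_section (x₀ := x₀) fun h => hE (h ▸ hx₀)
  have hmaps : MapsTo σ (E ∩ O) (polarPreimage Ψ E) := fun x hx =>
    ⟨(hσO x hx.2).1.le, by rw [(hσO x hx.2).2]; exact hx.1⟩
  -- The branch `σ` and `polarInv` differ by an angular translation, which `F` does not see.
  have heq : ∀ x ∈ E ∩ O, (F ∘ polarInv Ψ) x = (F ∘ σ) x := fun x hx => by
    obtain ⟨k, hk⟩ := hΨ.exists_eq_polarInv_add (hσO x hx.2).1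
    rw [(hσO x hx.2).2] at hk
    rw [comp_apply, comp_apply, hk, hper _ (hΨ.polarInv_mem_polarPreimage hx.1)]
  have : ContinuousWithinAt (F ∘ polarInv Ψ) (E ∩ O) x₀ :=
    (hF.comp (hσ.mono inter_subset_right) hmaps).congr heq x₀ ⟨hx₀, hx₀O⟩
  exact (continuousWithinAt_inter (hO.mem_nhds hx₀O)).1 this

/-- The image of the level `r = ε` is compact and misses `0`, so the radius never equals `ε` on a
small punctured ball. That ball is connected and contains points `Ψ (0, s)` of radius below `ε`, so
the radius stays below `ε`. -/
theorem eventually_polarInv_snd_lt (hΨ : IsPolarLike Ψ) {ε : ℝ} (hε : 0 < ε) :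
    ∀ᶠ x in 𝓝 (0 : ℝ × ℝ), (polarInv Ψ x).2 < ε := by
  have hr : ContinuousOn (fun x => (polarInv Ψ x).2) {0}ᶜ :=
    hΨ.continuousOn_comp_polarInv (F := Prod.snd) (by simp) continuousOn_snd
      fun y _ k => add_rotationValue_snd y k
  have hsub : Icc 0 (2 * Real.pi) ×ˢ {ε} ⊆ closedHalfPlane := fun y hy =>
    (show 0 ≤ y.2 from (show y.2 = ε from hy.2) ▸ hε.le)
  have hK : IsCompact (Ψ '' (Icc 0 (2 * Real.pi) ×ˢ {ε})) :=
    (isCompact_Icc.prod isCompact_singleton).image_of_continuousOn (hΨ.continuousOn.mono hsub)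
  have h0K : (0 : ℝ × ℝ) ∈ (Ψ '' (Icc 0 (2 * Real.pi) ×ˢ {ε}))ᶜ := by
    rintro ⟨y, hy, hy0⟩
    exact hΨ.ne_zero (show 0 < y.2 from (show y.2 = ε from hy.2) ▸ hε) hy0
  obtain ⟨ρ, hρ, hρK⟩ := Metric.mem_nhds_iff.1 (hK.isClosed.isOpen_compl.mem_nhds h0K)
  obtain ⟨x₁, hx₁, hx₁ε⟩ : ∃ x₁ ∈ Metric.ball (0 : ℝ × ℝ) ρ \ {0}, (polarInv Ψ x₁).2 < ε := by
    have h0 : Ψ (0, 0) = 0 := (hΨ.origin (0, 0) (le_refl (0 : ℝ))).2 rfl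
    have hlim : Filter.Tendsto (fun s : ℝ => Ψ (0, s)) (𝓝[>] 0) (𝓝 0) := by
      have h1 : ContinuousWithinAt Ψ closedHalfPlane (0, 0) :=
        hΨ.continuousOn _ (le_refl (0 : ℝ))
      have h2 : ContinuousWithinAt (fun s : ℝ => ((0 : ℝ), s)) (Ioi 0) 0 := by fun_prop
      have := h1.comp h2 fun s (hs : 0 < s) => (show (0 : ℝ) ≤ s from hs.le)
      rw [ContinuousWithinAt, comp_apply, h0] at this
      exact this
    have := (hlim.eventually (Metric.ball_mem_nhds 0 hρ)).and (Ioo_mem_nhdsGT hε)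
    obtain ⟨s, hs, hs0, hsε⟩ := this.exists
    obtain ⟨k, hk⟩ := hΨ.exists_eq_polarInv_add (y := (0, s)) hs0
    refine ⟨Ψ (0, s), ⟨hs, hΨ.ne_zero hs0⟩, ?_⟩
    have := congrArg Prod.snd hk
    rw [add_rotationValue_snd] at this
    rwa [← this]
  filter_upwards [Metric.ball_mem_nhds 0 hρ] with x hx
  by_cases hx0 : x = 0
  · rw [hx0, hΨ.polarInv_zero]
    exact hε
  by_contra! hge
  obtain ⟨z, hz, hzε⟩ := (isPreconnected_ball_diff_center hρ).intermediate_value hx₁ ⟨hx, hx0⟩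
    (hr.mono fun x hx => hx.2) ⟨hx₁ε.le, hge⟩
  exact hρK hz.1 ⟨polarInv Ψ z, ⟨hΨ.polarInv_fst_mem z, hzε⟩, hΨ.apply_polarInv z⟩

end IsPolarLike

theorem IsPolarExtension.add_rotationValue {Ψ F G : ℝ × ℝ → ℝ × ℝ} {U : Set (ℝ × ℝ)}
    (hG : IsPolarExtension Ψ F U G) {y : ℝ × ℝ} (hy : 0 ≤ y.2) (k : ℤ) :
    G (y + rotationValue k) = G y := apply_add_rotationValue hG.periodic hy k

/-- At the origin the angle has no limit, but the radius tends to `0` and `G` is constant on `r =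
0`; uniform continuity on a compact strip concludes. -/
theorem IsPolarExtension.continuous_comp_polarInv {Ψ F G : ℝ × ℝ → ℝ × ℝ} {U : Set (ℝ × ℝ)}
    (hΨ : IsPolarLike Ψ) (hG : IsPolarExtension Ψ F U G) : Continuous (G ∘ polarInv Ψ) := by
  rw [continuous_iff_continuousAt]
  intro x
  by_cases hx : x = 0
  · subst hx
    obtain ⟨v₀, hv₀⟩ := hG.const
    have hcpt : IsCompact (Icc 0 (2 * Real.pi) ×ˢ Icc (0 : ℝ) 1) := isCompact_Icc.prod isCompact_Icc
    have huc := hcpt.uniformContinuousOn_of_continuous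
      (hG.continuousOn.mono fun y hy => hy.2.1)
    rw [Metric.continuousAt_iff']
    intro ε hε
    obtain ⟨δ, hδ, hδε⟩ := Metric.uniformContinuousOn_iff.1 huc ε hε
    filter_upwards [hΨ.eventually_polarInv_snd_lt hδ, hΨ.eventually_polarInv_snd_lt one_pos]
      with x h1 h2
    have hθ := hΨ.polarInv_fst_mem x
    have hr := hΨ.polarInv_nonneg x
    have := hδε (polarInv Ψ x) ⟨hθ, hr, h2.le⟩ ((polarInv Ψ x).1, 0) ⟨hθ, le_rfl, zero_le_one⟩
      (by
        rw [Prod.dist_eq, dist_self, Real.dist_eq, sub_zero, abs_of_nonneg hr]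
        exact max_lt hδ h1)
    rw [hv₀] at this
    rw [comp_apply, comp_apply, hΨ.polarInv_zero]
    rwa [show G 0 = v₀ from hv₀ 0]
  · exact (hΨ.continuousOn_comp_polarInv (E := {0}ᶜ) (by simp)
      (hG.continuousOn.mono fun y hy => hy.1)
      fun y hy k => hG.add_rotationValue hy.1 k).continuousAt (isOpen_compl_singleton.mem_nhds hx)

/-- Only boundary values matter for the degree, so the chosen extension can be exchanged for any `g`
in the plane. Composing a planar extension with `Ψ` shows that periodic extensions exist. -/
theorem polarDegree_eq_brouwerDegree {Ψ F g : ℝ × ℝ → ℝ × ℝ} (hΨ : IsPolarLike Ψ)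
    {U : Set (ℝ × ℝ)} (hUo : IsOpen U) (hUb : Bornology.IsBounded U) (h0 : 0 ∉ frontier U)
    (hF : ContinuousOn F (polarPreimage Ψ (frontier U)))
    (hper : ∀ y ∈ polarPreimage Ψ (frontier U), ∀ k : ℤ, F (y + rotationValue k) = F y)
    (hg : ContinuousOn g (closure U)) (hgF : EqOn g (F ∘ polarInv Ψ) (frontier U)) {v : ℝ × ℝ}
    (hv : ∀ x ∈ frontier U, g x ≠ v) : polarDegree Ψ F U v = brouwerDegree g U v := by
  have hex : ∃ G, IsPolarExtension Ψ F U G := by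
    obtain ⟨g', hg', hgg'⟩ := exists_continuous_extension isClosed_frontier
      (hΨ.continuousOn_comp_polarInv h0 hF hper)
    refine ⟨g' ∘ Ψ, hg'.comp_continuousOn hΨ.continuousOn, fun θ r hr => ?_, fun y hy => ?_,
      g' 0, fun θ => ?_⟩
    · simp [hΨ.periodic θ r hr]
    · rw [comp_apply, hgg' hy.2, comp_apply]
      have hy0 : 0 < y.2 := hΨ.pos_of_ne_zero hy.1 fun h => h0 (h ▸ hy.2)
      obtain ⟨k, hk⟩ := hΨ.exists_eq_polarInv_add hy0
      conv_rhs => rw [hk]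
      rw [hper _ (hΨ.polarInv_mem_polarPreimage hy.2)]
    · rw [comp_apply, (hΨ.origin (θ, 0) (le_refl (0 : ℝ))).2 rfl]
  rw [polarDegree, dif_pos hex]
  have hG := hex.choose_spec
  have heq : EqOn g (hex.choose ∘ polarInv Ψ) (frontier U) := fun x hx => by
    rw [hgF hx, comp_apply, comp_apply, hG.eqOn (hΨ.polarInv_mem_polarPreimage hx)]
  exact (brouwerDegree_eq_of_eqOn_frontier hUo hUb hg
    (hG.continuous_comp_polarInv hΨ).continuousOn heq hv).symm

/-! ## Lifting through polar-like coordinates -/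

theorem isOpen_openHalfPlane : IsOpen openHalfPlane := isOpen_lt continuous_const continuous_snd

/-- The deck transformations of the angular coordinate. -/
@[reducible] noncomputable def angularAction : AddAction ℤ openHalfPlane where
  vadd k y := ⟨y.1 + rotationValue k, by
    change 0 < (y.1 + rotationValue k).2
    rw [add_rotationValue_snd]
    exact y.2⟩
  zero_vadd y := Subtype.ext (by
    change y.1 + rotationValue 0 = y.1
    rw [rotationValue_zero, add_zero])
  add_vadd j k y := Subtype.ext (by
    change y.1 + rotationValue (j + k) = y.1 + rotationValue k + rotationValue j
    rw [rotationValue_add]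
    abel)

namespace IsPolarLike

variable {Ψ : ℝ × ℝ → ℝ × ℝ}

/-- Polar-like coordinates as a map from the open half-plane to the punctured plane. -/
def toPunctured (hΨ : IsPolarLike Ψ) (y : openHalfPlane) : ({0}ᶜ : Set (ℝ × ℝ)) :=
  ⟨Ψ y.1, hΨ.ne_zero y.2⟩

/-- `Ψ` is open and surjective and its fibres are the orbits of a properly discontinuous action of
`ℤ`, so it is a quotient covering. -/
theorem isCoveringMap_toPunctured (hΨ : IsPolarLike Ψ) : IsCoveringMap hΨ.toPunctured := by
  let _ := angularAction
  have hcont : Continuous hΨ.toPunctured := by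
    refine Continuous.subtype_mk ?_ _
    exact (hΨ.continuousOn.mono fun y (hy : 0 < y.2) => (show 0 ≤ y.2 from hy.le)).domRestrict
  have hopen : IsOpenMap hΨ.toPunctured := by
    intro W hW
    have h1 : IsOpen (Subtype.val '' W) := isOpen_openHalfPlane.isOpenMap_subtype_val W hW
    have h2 : IsOpen (Ψ '' (Subtype.val '' W)) := by
      refine isOpen_iff_mem_nhds.2 ?_
      rintro _ ⟨y, hy, rfl⟩
      have hyH : y ∈ openHalfPlane := by
        obtain ⟨w, -, rfl⟩ := hy
        exact w.2
      rw [← hΨ.localHomeo.map_nhds_eq hyH]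
      exact Filter.image_mem_map (h1.mem_nhds hy)
    convert h2.preimage continuous_subtype_val using 1
    ext x
    constructor
    · rintro ⟨y, hy, rfl⟩
      exact ⟨y.1, mem_image_of_mem _ hy, rfl⟩
    · rintro ⟨_, ⟨y, hy, rfl⟩, hyx⟩
      exact ⟨y, hy, Subtype.ext hyx⟩
  have hsurj : Surjective hΨ.toPunctured := fun x =>
    ⟨⟨polarInv Ψ x.1, hΨ.polarInv_pos x.2⟩, Subtype.ext (hΨ.apply_polarInv x.1)⟩
  have hq : IsAddQuotientCoveringMap hΨ.toPunctured ℤ :=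
    { toIsQuotientMap := hopen.isQuotientMap hcont hsurj
      continuous_const_vadd := fun k =>
        (continuous_subtype_val.add continuous_const).subtype_mk _
      apply_eq_iff_mem_orbit := fun {a b} => by
        constructor
        · intro h
          obtain ⟨k, hk⟩ := hΨ.exists_eq_add_rotationValue b.2 (le_of_lt a.2)
            (congrArg Subtype.val h).symm
          exact ⟨k, Subtype.ext hk.symm⟩
        · rintro ⟨k, rfl⟩
          exact Subtype.ext (hΨ.add_rotationValue (le_of_lt b.2) k)
      disjoint := fun y => by
        -- An open vertical strip of width `2π` is disjoint from all its nontrivial translates.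
        refine ⟨{z | |z.1.1 - y.1.1| < Real.pi}, ?_, fun k hk => ?_⟩
        · refine IsOpen.mem_nhds (isOpen_lt (by fun_prop) continuous_const) ?_
          simp [Real.pi_pos]
        · obtain ⟨_, ⟨z, hz, rfl⟩, hz'⟩ := hk
          have h1 : |z.1.1 - y.1.1| < Real.pi := hz
          have h2 : |z.1.1 + 2 * Real.pi * k - y.1.1| < Real.pi := hz'
          rw [abs_lt] at h1 h2
          have h3 : (k : ℝ) < 1 := by nlinarith [Real.pi_pos]
          have h4 : (-1 : ℝ) < k := by nlinarith [Real.pi_pos]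
          have h5 : k < 1 := by exact_mod_cast h3
          have h6 : -1 < k := by exact_mod_cast h4
          omega }
  exact hq.isCoveringMap

theorem polarPreimage_subset_openHalfPlane (hΨ : IsPolarLike Ψ) {E : Set (ℝ × ℝ)} (hE : 0 ∉ E) :
    polarPreimage Ψ E ⊆ openHalfPlane := fun _ hy =>
  hΨ.pos_of_ne_zero hy.1 fun h => hE (h ▸ hy.2)

theorem add_rotationValue_mem_polarPreimage (hΨ : IsPolarLike Ψ) {E : Set (ℝ × ℝ)} {y : ℝ × ℝ}
    (hy : y ∈ polarPreimage Ψ E) (k : ℤ) : y + rotationValue k ∈ polarPreimage Ψ E :=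
  ⟨by rw [closedHalfPlane, mem_ofPred_eq, add_rotationValue_snd]; exact hy.1,
    by rw [hΨ.add_rotationValue hy.1]; exact hy.2⟩

/-- Homotopy lifting through the covering, after rescaling time to the unit interval. The initial
condition keeps `0` out of `E`. -/
theorem isEvolutionLift_evolutionLift (hΨ : IsPolarLike Ψ) {T : ℝ} (hT : 0 ≤ T)
    {φ : ℝ → ℝ × ℝ → ℝ × ℝ} {E : Set (ℝ × ℝ)}
    (hφ : ContinuousOn (uncurry φ) (Icc 0 T ×ˢ E)) (hφ0 : ∀ x ∈ E, φ 0 x = x)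
    (hφN : ∀ t ∈ Icc 0 T, ∀ x ∈ E, φ t x ≠ 0) :
    IsEvolutionLift Ψ T φ E (evolutionLift Ψ T φ E) := by
  classical
  have hE : 0 ∉ E := fun h => hφN 0 (left_mem_Icc.2 hT) 0 h (hφ0 0 h)
  have hPH := hΨ.polarPreimage_subset_openHalfPlane hE
  have hmul (s : unitInterval) : T * s.1 ∈ Icc 0 T :=
    ⟨mul_nonneg hT s.2.1, mul_le_of_le_one_right hT s.2.2⟩
  let H : C(unitInterval × polarPreimage Ψ E, ({0}ᶜ : Set (ℝ × ℝ))) :=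
    ⟨fun q => ⟨φ (T * q.1.1) (Ψ q.2.1), hφN _ (hmul q.1) _ q.2.2.2⟩, by
      refine Continuous.subtype_mk ?_ _
      have hc : Continuous fun q : unitInterval × polarPreimage Ψ E => (T * q.1.1, Ψ q.2.1) := by
        refine (by fun_prop : Continuous fun q : unitInterval × polarPreimage Ψ E =>
          T * q.1.1).prodMk ?_
        exact (hΨ.continuousOn.mono fun y (hy : y ∈ polarPreimage Ψ E) => hy.1).domRestrict.comp
          continuous_snd
      exact hφ.comp_continuous hc fun q => ⟨hmul q.1, q.2.2.2⟩⟩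
  let f : C(polarPreimage Ψ E, openHalfPlane) :=
    ⟨fun y => ⟨y.1, hPH y.2⟩, continuous_subtype_val.subtype_mk _⟩
  have hH0 : ∀ y, H (0, y) = hΨ.toPunctured (f y) := fun y => Subtype.ext (by
    change φ (T * 0) (Ψ y.1) = Ψ y.1
    rw [mul_zero, hφ0 _ y.2.2])
  let L := hΨ.isCoveringMap_toPunctured.liftHomotopy H f hH0
  have hex : ∃ Φ, IsEvolutionLift Ψ T φ E Φ := by
    let Φ : ℝ → ℝ × ℝ → ℝ × ℝ := fun t y =>
      if h : y ∈ polarPreimage Ψ E then (L (projIcc 0 1 zero_le_one (t / T), ⟨y, h⟩)).1 else y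
    have hΦ (t : ℝ) (y : ℝ × ℝ) (h : y ∈ polarPreimage Ψ E) :
        Φ t y = (L (projIcc 0 1 zero_le_one (t / T), ⟨y, h⟩)).1 := dif_pos h
    refine ⟨Φ, ?_, fun t _ y hy => ?_, fun y hy => ?_, fun t ht y hy => ?_⟩
    · rw [continuousOn_iff_continuous_domRestrict]
      have : Continuous fun q : ↥(Icc 0 T ×ˢ polarPreimage Ψ E) =>
          (L (projIcc 0 1 zero_le_one (q.1.1 / T), ⟨q.1.2, q.2.2⟩)).1 := by
        refine continuous_subtype_val.comp (L.continuous.comp ?_)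
        refine (continuous_projIcc.comp ?_).prodMk (Continuous.subtype_mk ?_ _)
        · fun_prop
        · fun_prop
      convert this using 1
      funext q
      exact hΦ _ _ q.2.2
    · rw [hΦ t y hy]
      exact Subtype.coe_prop _
    · rw [hΦ 0 y hy]
      have : projIcc (0 : ℝ) 1 zero_le_one (0 / T) = 0 := by
        rw [zero_div]; exact projIcc_left (zero_le_one : (0 : ℝ) ≤ 1)
      rw [this, hΨ.isCoveringMap_toPunctured.liftHomotopy_zero]
      rfl
    · have h1 := congrArg Subtype.val (congrFun
        (hΨ.isCoveringMap_toPunctured.liftHomotopy_lifts H f hH0)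
        (projIcc 0 1 zero_le_one (t / T), ⟨y, hy⟩))
      have h2 : T * (projIcc (0 : ℝ) 1 zero_le_one (t / T)).1 = t := by
        rw [projIcc_of_mem zero_le_one ⟨div_nonneg ht.1 hT, div_le_one_of_le₀ ht.2 hT⟩]
        -- For `T = 0` the quotient `t / T` is `0` by convention, and `t = 0` as well.
        rcases hT.eq_or_lt with rfl | hT
        · rw [zero_mul]
          exact le_antisymm ht.1 ht.2
        · exact mul_div_cancel₀ t hT.ne'
      rw [hΦ t y hy]
      change Ψ (L _).1 = φ (T * (projIcc (0 : ℝ) 1 zero_le_one (t / T)).1) (Ψ y) at h1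
      rw [h1, h2]
  rw [evolutionLift, dif_pos hex]
  exact hex.choose_spec

/-- The paths from `y` and from its translate lie over the same path, so they differ by `2π m(t)` in
the angle with `m` continuous and integer valued, hence equal to `m(0) = k`. This gives the
periodicity of `F_T`. -/
theorem _root_.IsEvolutionLift.add_rotationValue (hΨ : IsPolarLike Ψ) {T : ℝ} (hT : 0 ≤ T)
    {φ : ℝ → ℝ × ℝ → ℝ × ℝ} {E : Set (ℝ × ℝ)} {Φ : ℝ → ℝ × ℝ → ℝ × ℝ}
    (hΦ : IsEvolutionLift Ψ T φ E Φ) {y : ℝ × ℝ} (hy : y ∈ polarPreimage Ψ E) (k : ℤ) :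
    Φ T (y + rotationValue k) = Φ T y + rotationValue k := by
  have hy' := hΨ.add_rotationValue_mem_polarPreimage hy k
  have hm (t : ℝ) (ht : t ∈ Icc 0 T) :
      ∃ m : ℤ, Φ t (y + rotationValue k) = Φ t y + rotationValue m := by
    refine hΨ.exists_eq_add_rotationValue (hΦ.mem t ht y hy) (le_of_lt (hΦ.mem t ht _ hy')) ?_
    rw [hΦ.lift t ht y hy, hΦ.lift t ht _ hy', hΨ.add_rotationValue hy.1]
  choose! m hm using hm
  have hc (z : ℝ × ℝ) (hz : z ∈ polarPreimage Ψ E) : ContinuousOn (fun t => Φ t z) (Icc 0 T) :=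
    hΦ.continuousOn.comp (continuousOn_id.prodMk continuousOn_const) fun t ht => ⟨ht, hz⟩
  have hmc : ContinuousOn m (Icc 0 T) := by
    rw [Int.isClosedEmbedding_coe_real.isInducing.continuousOn_iff]
    have h1 : ContinuousOn (fun t => (Φ t (y + rotationValue k) - Φ t y).1 / (2 * Real.pi))
        (Icc 0 T) := (((hc _ hy').sub (hc _ hy)).fst).div_const _
    refine h1.congr fun t ht => ?_
    change (m t : ℝ) = (Φ t (y + rotationValue k) - Φ t y).1 / (2 * Real.pi)
    rw [hm t ht, add_sub_cancel_left]
    exact (mul_div_cancel_left₀ _ Real.two_pi_pos.ne').symm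
  have hmT : m T = m 0 := isPreconnected_Icc.constant hmc (right_mem_Icc.2 hT) (left_mem_Icc.2 hT)
  have hm0 : m 0 = k := by
    have h0 := hm 0 (left_mem_Icc.2 hT)
    rw [hΦ.initial _ hy', hΦ.initial _ hy] at h0
    exact (rotationValue_injective (add_left_cancel h0)).symm
  rw [hm T (right_mem_Icc.2 hT), hmT, hm0]

end IsPolarLike

/-! ## Displacements in polar-like coordinates -/

/-- The retraction of the plane onto the closed half-plane. -/
def clampRadius (y : ℝ × ℝ) : ℝ × ℝ := (y.1, max y.2 0)

theorem continuous_clampRadius : Continuous clampRadius := by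
  unfold clampRadius; fun_prop

theorem clampRadius_mem (y : ℝ × ℝ) : clampRadius y ∈ closedHalfPlane := le_max_right y.2 0

theorem clampRadius_of_nonneg {y : ℝ × ℝ} (hy : 0 ≤ y.2) : clampRadius y = y := by
  simp [clampRadius, hy]

theorem clampRadius_add_rotationValue (y : ℝ × ℝ) (k : ℤ) :
    clampRadius (y + rotationValue k) = clampRadius y + rotationValue k := by
  simp [clampRadius, rotationValue]

/-- The point obtained from `x` by adding `w` to its polar-like coordinates. -/
noncomputable def polarShift (Ψ : ℝ × ℝ → ℝ × ℝ) (x w : ℝ × ℝ) : ℝ × ℝ :=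
  Ψ (clampRadius (polarInv Ψ x + w))

namespace IsPolarLike

variable {Ψ : ℝ × ℝ → ℝ × ℝ}

theorem continuous_comp_clampRadius (hΨ : IsPolarLike Ψ) : Continuous fun y => Ψ (clampRadius y) :=
  hΨ.continuousOn.comp_continuous continuous_clampRadius clampRadius_mem

theorem clampRadius_congr (hΨ : IsPolarLike Ψ) (y : ℝ × ℝ) (k : ℤ) :
    Ψ (clampRadius (y + rotationValue k)) = Ψ (clampRadius y) := by
  rw [clampRadius_add_rotationValue, hΨ.add_rotationValue (clampRadius_mem y)]

/-- Clamping a negative radius would land on the line `r = 0`, which `Ψ` sends to the origin. As `Ψ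
y ≠ 0`, no clamping has occurred. -/
theorem exists_eq_rotationValue_of_clampRadius (hΨ : IsPolarLike Ψ) {y w : ℝ × ℝ} (hy : 0 < y.2)
    (h : Ψ (clampRadius (y + w)) = Ψ y) : ∃ k : ℤ, w = rotationValue k := by
  obtain ⟨k, hk⟩ := hΨ.exists_eq_add_rotationValue hy (clampRadius_mem (y + w)) h.symm
  have h2 := congrArg Prod.snd hk
  rw [add_rotationValue_snd] at h2
  have hpos : 0 ≤ (y + w).2 := by
    by_contra! hneg
    have : (clampRadius (y + w)).2 = 0 := max_eq_right hneg.le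
    linarith
  rw [clampRadius_of_nonneg hpos] at hk
  exact ⟨k, add_left_cancel hk⟩

theorem polarShift_eq_of_section (hΨ : IsPolarLike Ψ) {x y : ℝ × ℝ} (hy : 0 < y.2) (h : Ψ y = x)
    (w : ℝ × ℝ) : polarShift Ψ x w = Ψ (clampRadius (y + w)) := by
  obtain ⟨k, hk⟩ := hΨ.exists_eq_polarInv_add hy
  rw [h] at hk
  rw [hk, add_right_comm, hΨ.clampRadius_congr, polarShift]

theorem exists_eq_rotationValue_of_polarShift (hΨ : IsPolarLike Ψ) {x w : ℝ × ℝ} (hx : x ≠ 0)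
    (h : polarShift Ψ x w = x) : ∃ k : ℤ, w = rotationValue k :=
  hΨ.exists_eq_rotationValue_of_clampRadius (hΨ.polarInv_pos hx)
    (h.trans (hΨ.apply_polarInv x).symm)

theorem polarShift_rotationValue (hΨ : IsPolarLike Ψ) (x : ℝ × ℝ) (k : ℤ) :
    polarShift Ψ x (rotationValue k) = x := by
  rw [polarShift, hΨ.clampRadius_congr, clampRadius_of_nonneg (hΨ.polarInv_nonneg x),
    hΨ.apply_polarInv]

theorem continuousOn_polarShift (hΨ : IsPolarLike Ψ) :
    ContinuousOn (fun p : (ℝ × ℝ) × (ℝ × ℝ) => polarShift Ψ p.1 p.2) {p | p.1 ≠ 0} := by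
  intro p hp
  obtain ⟨σ, O, hO, hxO, hσ, hσO⟩ := hΨ.exists_section hp
  refine ContinuousAt.continuousWithinAt ?_
  have h1 : ContinuousAt (fun p : (ℝ × ℝ) × (ℝ × ℝ) => σ p.1) p :=
    (hσ.continuousAt (hO.mem_nhds hxO)).comp continuousAt_fst
  have h2 : ContinuousAt (fun p : (ℝ × ℝ) × (ℝ × ℝ) => Ψ (clampRadius (σ p.1 + p.2))) p :=
    hΨ.continuous_comp_clampRadius.continuousAt.comp (h1.add continuousAt_snd)
  refine h2.congr ?_
  filter_upwards [(hO.preimage continuous_fst).mem_nhds hxO] with q hq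
  exact (hΨ.polarShift_eq_of_section (hσO _ hq).1 (hσO _ hq).2 _).symm

/-! ### Degree of a displacement away from the origin -/

/-- Index of a simple zero. With a local branch `σ` the displacement is `Ψ(σ x + w x) - Ψ(σ x)`;
sliding `σ x` to `y₀` turns it into `Ψ ∘ k` minus a constant, with `k` a local diffeomorphism. -/
theorem brouwerDegree_polarShift_ball (hΨ : IsPolarLike Ψ) {g : ℝ × ℝ → ℝ × ℝ}
    (hg : ContDiff ℝ (⊤ : ℕ∞) g) {x₀ : ℝ × ℝ} (hx₀ : x₀ ≠ 0) {i : ℤ} (hgx₀ : g x₀ = rotationValue i)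
    (hdet : (fderiv ℝ g x₀).det ≠ 0) :
    ∀ᶠ ε in 𝓝[>] (0 : ℝ), brouwerDegree (fun x => polarShift Ψ x (g x) - x) (Metric.ball x₀ ε) 0 =
      (SignType.sign (fderiv ℝ g x₀).det : ℤ) := by
  obtain ⟨σ, O, hO, hxO, hσ, hσO⟩ := hΨ.exists_section hx₀
  set y₀ := σ x₀ with hy₀
  have hy₀pos : 0 < y₀.2 := (hσO x₀ hxO).1
  let w : ℝ × ℝ → ℝ × ℝ := fun x => g x - rotationValue i
  let k : ℝ × ℝ → ℝ × ℝ := fun x => y₀ + w x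
  have hw0 : w x₀ = 0 := sub_eq_zero.2 hgx₀
  have hkx₀ : k x₀ = y₀ := by simp only [k, hw0, add_zero]
  have hwc : Continuous w := hg.continuous.sub continuous_const
  have hk : ContDiff ℝ (⊤ : ℕ∞) k := contDiff_const.add (hg.sub contDiff_const)
  have hkfd (x : ℝ × ℝ) : fderiv ℝ k x = fderiv ℝ g x := by
    simp only [k, w, fderiv_const_add, fderiv_sub_const]
  -- The bound `2π` leaves `0` as the only rotation value that `w` can take near `x₀`.
  have hW : O ∩ {x | |(w x).1| < 2 * Real.pi} ∈ 𝓝 x₀ := by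
    refine Filter.inter_mem (hO.mem_nhds hxO) (IsOpen.mem_nhds
      (isOpen_lt (by fun_prop) continuous_const) ?_)
    simp [hw0, Real.pi_pos]
  obtain ⟨N, hNW, hNo, hxN, hinj, -, hsign⟩ := exists_injOn_sign_const hk
    (by rwa [hkfd]) hW
  rw [hkfd] at hsign
  obtain ⟨ε₀, hε₀, hball⟩ := Metric.mem_nhds_iff.1 (hNo.mem_nhds hxN)
  filter_upwards [Ioo_mem_nhdsGT hε₀] with ε hε
  set B := Metric.ball x₀ ε with hB
  have hBo : IsOpen B := Metric.isOpen_ball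
  have hBb : Bornology.IsBounded B := Metric.isBounded_ball
  have hcl : closure B ⊆ N := Metric.closure_ball_subset_closedBall.trans
    ((Metric.closedBall_subset_ball hε.2).trans hball)
  have hx₀B : x₀ ∈ B := Metric.mem_ball_self hε.1
  have hzero : ∀ x ∈ closure B, ∀ y : ℝ × ℝ, 0 < y.2 → Ψ (clampRadius (y + w x)) = Ψ y →
      x = x₀ := by
    intro x hx y hy h
    obtain ⟨m, hm⟩ := hΨ.exists_eq_rotationValue_of_clampRadius hy h
    have h1 : |(w x).1| < 2 * Real.pi := (hNW (hcl hx)).2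
    have h2 : (w x).1 = 2 * Real.pi * m := by rw [hm, rotationValue]
    rw [h2, abs_mul, abs_of_pos Real.two_pi_pos] at h1
    have h3 : |(m : ℝ)| < 1 := by
      by_contra! hge
      nlinarith [Real.two_pi_pos]
    have h4 : m = 0 := Int.abs_lt_one_iff.1 (by exact_mod_cast h3)
    rw [h4, rotationValue_zero] at hm
    exact hinj (hcl hx) hxN (by simp only [k, hm, hw0])
  have hfrne : ∀ x ∈ frontier B, x ≠ x₀ := fun x hx he => by
    rw [hBo.frontier_eq] at hx
    exact hx.2 (he ▸ hx₀B)
  -- The open half-plane is convex, so the moving base point keeps a positive radius and `hzero`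
  -- excludes boundary zeros throughout.
  let y : ℝ → ℝ × ℝ → ℝ × ℝ := fun s x => σ x + s • (y₀ - σ x)
  have hypos : ∀ s ∈ Icc (0 : ℝ) 1, ∀ x ∈ closure B, 0 < (y s x).2 := by
    intro s hs x hx
    have h1 := (hσO x (hNW (hcl hx)).1).1
    have h2 : (y s x).2 = (1 - s) * (σ x).2 + s * y₀.2 := by
      simp only [y, Prod.snd_add, Prod.smul_snd, Prod.snd_sub, smul_eq_mul]
      ring
    rw [h2]
    rcases hs.1.eq_or_lt with h | h
    · rw [← h]; simpa using h1
    · have := mul_pos h hy₀pos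
      have := mul_nonneg (sub_nonneg.2 hs.2) h1.le
      linarith
  have hσB : ContinuousOn σ (closure B) := hσ.mono fun x hx => (hNW (hcl hx)).1
  have hyc : ContinuousOn (uncurry y) (Icc 0 1 ×ˢ closure B) := by
    have h1 : ContinuousOn (fun p : ℝ × (ℝ × ℝ) => σ p.2) (Icc 0 1 ×ˢ closure B) :=
      hσB.comp continuousOn_snd fun p hp => hp.2
    exact h1.add (continuousOn_fst.smul (continuousOn_const.sub h1))
  have hhom := brouwerDegree_homotopy (v := 0)
    (H := fun s x => Ψ (clampRadius (y s x + w x)) - Ψ (clampRadius (y s x))) hBo hBb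
    ((hΨ.continuous_comp_clampRadius.comp_continuousOn
      (hyc.add (hwc.comp_continuousOn continuousOn_snd))).sub
      (hΨ.continuous_comp_clampRadius.comp_continuousOn hyc))
    fun s hs x hx h0 => by
      have hx' := frontier_subset_closure hx
      have hp := hypos s hs x hx'
      rw [sub_eq_zero, clampRadius_of_nonneg hp.le] at h0
      exact hfrne x hx (hzero x hx' _ hp h0)
  have hstart : brouwerDegree (fun x => polarShift Ψ x (g x) - x) B 0 =
      brouwerDegree (fun x => Ψ (clampRadius (y 0 x + w x)) - Ψ (clampRadius (y 0 x))) B 0 := by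
    refine brouwerDegree_congr fun x hx => ?_
    obtain ⟨h1, h2⟩ := hσO x (hNW (hcl hx)).1
    have h3 : g x = w x + rotationValue i := (sub_add_cancel _ _).symm
    simp only [y, zero_smul, add_zero]
    rw [hΨ.polarShift_eq_of_section h1 h2, h3, ← add_assoc, hΨ.clampRadius_congr,
      clampRadius_of_nonneg h1.le, h2]
  have hend : brouwerDegree (fun x => Ψ (clampRadius (y 1 x + w x)) - Ψ (clampRadius (y 1 x))) B 0 =
      brouwerDegree (fun x => Ψ (clampRadius (k x)) - Ψ y₀) B 0 := by
    refine brouwerDegree_congr fun x _ => ?_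
    simp only [y, one_smul, add_sub_cancel, k]
    rw [clampRadius_of_nonneg hy₀pos.le]
  have hΨk : Continuous fun x => Ψ (clampRadius (k x)) :=
    hΨ.continuous_comp_clampRadius.comp hk.continuous
  have hkne : ∀ x ∈ frontier B, Ψ (clampRadius (k x)) ≠ Ψ y₀ := fun x hx h0 =>
    hfrne x hx (hzero x (frontier_subset_closure hx) y₀ hy₀pos h0)
  rw [hstart, hhom, hend, brouwerDegree_sub_const hBo hBb hΨk.continuousOn hkne]
  have hcomp := brouwerDegree_comp (g := fun y => Ψ (clampRadius y)) hBo hBb hk (hinj.mono hcl)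
    (s := SignType.sign (fderiv ℝ g x₀).det) (sign_ne_zero.2 hdet)
    (fun x hx => hsign x (hcl (subset_closure hx)))
    hΨ.continuous_comp_clampRadius.continuousOn hkne
  have hkB : IsOpen (k '' B) := isOpen_image_of_det_ne_zero hk hBo fun x hx h0 => hdet (by
    rw [← sign_eq_zero_iff, ← hsign x (hcl (subset_closure hx)), h0, sign_zero])
  have hclk : closure (k '' B) = k '' closure B :=
    (image_closure_of_isCompact hBb.isCompact_closure hk.continuous.continuousOn).symm
  -- The point `y₀` is the only preimage of `Ψ y₀` in the closure of `k '' B`, so excision reduces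
  -- to a small ball, where the degree is `1` by orientation.
  have hlocal : brouwerDegree (fun y => Ψ (clampRadius y)) (k '' B) (Ψ y₀) = 1 := by
    have hy₀k : k '' B ∩ openHalfPlane ∈ 𝓝 y₀ := Filter.inter_mem
      (hkB.mem_nhds ⟨x₀, hx₀B, hkx₀⟩) (isOpen_openHalfPlane.mem_nhds hy₀pos)
    obtain ⟨ρ, hρ, hρs⟩ := Metric.mem_nhds_iff.1 hy₀k
    obtain ⟨r, hr1, hr0, hrρ⟩ := ((hΨ.orientation y₀ hy₀pos).and (Ioo_mem_nhdsGT hρ)).exists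
    have hsub : closure (Metric.ball y₀ r) ⊆ k '' B ∩ openHalfPlane :=
      Metric.closure_ball_subset_closedBall.trans ((Metric.closedBall_subset_ball hrρ).trans hρs)
    rw [← hr1, brouwerDegree_excision hkB
      ((hBb.isCompact_closure.image hk.continuous).isBounded.subset (image_mono subset_closure))
      hΨ.continuous_comp_clampRadius.continuousOn Metric.isOpen_ball
      (fun z hz => (hsub (subset_closure hz)).1)]
    · exact brouwerDegree_congr fun z hz => by
        rw [clampRadius_of_nonneg (le_of_lt (hsub hz).2)]
    · rintro z ⟨hz, hzr⟩ h0
      rw [hclk] at hz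
      obtain ⟨x, hx, rfl⟩ := hz
      have := hzero x hx y₀ hy₀pos h0
      rw [this, hkx₀] at hzr
      exact hzr (Metric.mem_ball_self hr0)
  rw [hlocal, mul_one] at hcomp
  exact hcomp

end IsPolarLike

namespace IsPolarLike

variable {Ψ : ℝ × ℝ → ℝ × ℝ}

/-- Away from the origin the degree of a displacement is the sum of the degrees of its expression in
polar-like coordinates at the values `rotationValue i`. -/
theorem brouwerDegree_polarShift (hΨ : IsPolarLike Ψ) {V : Set (ℝ × ℝ)} (hVo : IsOpen V)
    (hVb : Bornology.IsBounded V) (h0 : 0 ∉ closure V) {g : ℝ × ℝ → ℝ × ℝ}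
    (hg : ContinuousOn g (closure V)) (hν : ∀ x ∈ frontier V, ∀ i : ℤ, g x ≠ rotationValue i) :
    brouwerDegree (fun x => polarShift Ψ x (g x) - x) V 0 =
      ∑ᶠ i : ℤ, brouwerDegree g V (rotationValue i) := by
  classical
  obtain ⟨C, hC⟩ := (hVb.isCompact_closure.image_of_continuousOn hg).isBounded.exists_norm_le
  obtain ⟨N, hN⟩ := exists_nat_gt (C + 1)
  -- Since `‖ν_i‖ ≥ |i|`, indices outside `I` have `ν_i` at distance at least `1` from all values of
  -- `g`.
  let I : Finset ℤ := Finset.Icc (-N) N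
  have hI : ∀ (i : ℤ) (w : ℝ × ℝ), i ∉ I → ‖w‖ ≤ C → 1 ≤ ‖w - rotationValue i‖ := by
    intro i w hi hw
    have h1 : (N : ℝ) < |(i : ℝ)| := by
      have : (N : ℤ) < |i| := by
        rw [Finset.mem_Icc, ← abs_le] at hi
        exact not_le.1 hi
      exact_mod_cast this
    have h2 : |(i : ℝ)| ≤ ‖rotationValue i‖ := by
      refine le_trans ?_ (norm_fst_le (rotationValue i))
      rw [rotationValue, Real.norm_eq_abs, abs_mul, abs_of_pos Real.two_pi_pos]
      nlinarith [Real.pi_gt_three, abs_nonneg (i : ℝ)]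
    have h3 := norm_sub_norm_le (rotationValue i) w
    rw [norm_sub_rev] at h3
    linarith
  have hgC : ∀ x ∈ closure V, ‖g x‖ ≤ C := fun x hx => hC _ (mem_image_of_mem g hx)
  obtain ⟨m, hm, hm1, hmle⟩ : ∃ m > 0, m < 1 ∧ ∀ (i : ℤ), ∀ z ∈ frontier V,
      m ≤ ‖g z - rotationValue i‖ := by
    have h1 : ∀ᶠ m in 𝓝[>] (0 : ℝ), ∀ i ∈ I, ∀ z ∈ frontier V, m ≤ ‖g z - rotationValue i‖ := by
      rw [Filter.eventually_all_finset]
      intro i _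
      obtain ⟨m, hm, hmle⟩ := exists_pos_le_norm_sub (isCompact_frontier_of_isBounded hVb)
        (hg.mono frontier_subset_closure) (v := rotationValue i) fun x hx => hν x hx i
      filter_upwards [Ioo_mem_nhdsGT hm] with m' hm' z hz
      exact hm'.2.le.trans (hmle z hz)
    obtain ⟨m, hmI, hm, hm1⟩ := (h1.and (Ioo_mem_nhdsGT one_pos)).exists
    refine ⟨m, hm, hm1, fun i z hz => ?_⟩
    by_cases hi : i ∈ I
    · exact hmI i hi z hz
    · exact hm1.le.trans (hI i _ hi (hgC z (frontier_subset_closure hz)))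
  -- One `f` must serve every `i` at once. As `m < 1`, it takes no value `ν_i` with `i ∉ I`.
  obtain ⟨f, hf, hfg, hfreg⟩ := exists_smooth_regular_approx isClosed_closure hg hm
    (countable_range rotationValue)
  have hsegne : ∀ s ∈ Icc (0 : ℝ) 1, ∀ x ∈ frontier V, ∀ i : ℤ,
      g x + s • (f x - g x) ≠ rotationValue i := by
    intro s hs x hx i h
    have h1 := hmle i x hx
    rw [← h, sub_add_cancel_left, norm_neg, norm_smul, Real.norm_of_nonneg hs.1] at h1
    have h2 := hfg x (frontier_subset_closure hx)
    have h3 := mul_le_of_le_one_left (norm_nonneg (f x - g x)) hs.2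
    linarith
  have hdeg (i : ℤ) : brouwerDegree g V (rotationValue i) = brouwerDegree f V (rotationValue i) :=
    brouwerDegree_eq_of_segment hVo hVb hg hf.continuous.continuousOn
      fun s hs x hx => hsegne s hs x hx i
  have hfne (x : ℝ × ℝ) (hx : x ∈ frontier V) (i : ℤ) : f x ≠ rotationValue i := by
    have := hsegne 1 (right_mem_Icc.2 zero_le_one) x hx i
    rwa [one_smul, add_sub_cancel] at this
  have hfI : ∀ x ∈ closure V, ∀ i : ℤ, f x = rotationValue i → i ∈ I := by
    intro x hx i hi
    by_contra hiI
    have h1 := hI i (g x) hiI (hgC x hx)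
    rw [← hi, norm_sub_rev] at h1
    linarith [hfg x hx]
  have hnz : ∀ x ∈ closure V, x ≠ 0 := fun x hx h => h0 (h ▸ hx)
  have hgseg : ContinuousOn (fun p : ℝ × (ℝ × ℝ) => g p.2 + p.1 • (f p.2 - g p.2))
      (Icc 0 1 ×ˢ closure V) := by
    have h1 : ContinuousOn (fun p : ℝ × (ℝ × ℝ) => g p.2) (Icc 0 1 ×ˢ closure V) :=
      hg.comp continuousOn_snd fun p hp => hp.2
    exact h1.add (continuousOn_fst.smul
      ((hf.continuous.comp_continuousOn continuousOn_snd).sub h1))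
  have hhom := brouwerDegree_homotopy (v := 0)
    (H := fun s x => polarShift Ψ x (g x + s • (f x - g x)) - x) hVo hVb
    ((hΨ.continuousOn_polarShift.comp (continuousOn_snd.prodMk hgseg)
      fun p hp => hnz p.2 hp.2).sub continuousOn_snd) fun s hs x hx h => by
      obtain ⟨i, hi⟩ := hΨ.exists_eq_rotationValue_of_polarShift
        (hnz x (frontier_subset_closure hx)) (sub_eq_zero.1 h)
      exact hsegne s hs x hx i hi
  simp only [zero_smul, add_zero, one_smul, add_sub_cancel] at hhom
  have hfc : ContinuousOn (fun x => polarShift Ψ x (f x) - x) (closure V) :=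
    (hΨ.continuousOn_polarShift.comp (continuousOn_id.prodMk hf.continuous.continuousOn)
      fun x hx => hnz x hx).sub continuousOn_id
  have hfin (i : ℤ) : {x | x ∈ V ∧ f x = rotationValue i}.Finite :=
    finite_preimage_of_regular hf hVb (fun x hx => hfne x hx i)
      fun x _ => hfreg _ (mem_range_self i) x
  let Z : ℤ → Finset (ℝ × ℝ) := fun i => (hfin i).toFinset
  have hZ (i : ℤ) (x : ℝ × ℝ) : x ∈ Z i ↔ x ∈ V ∧ f x = rotationValue i := by
    simp [Z]
  have hdegf (i : ℤ) : brouwerDegree f V (rotationValue i) =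
      ∑ z ∈ Z i, (SignType.sign (fderiv ℝ f z).det : ℤ) := by
    rw [brouwerDegree_of_regular hVo hVb hf (fun x hx => hfne x hx i)
      fun x _ => hfreg _ (mem_range_self i) x, signedCount, ← finsum_mem_coe_finset,
      Finite.coe_toFinset]
  -- Both sides become the sum of the same signs over the zeros of the displacement, grouped on the
  -- right by the value `ν_i`.
  rw [hhom, finsum_congr hdeg, brouwerDegree_eq_sum_local hVo hVb hfc (I.biUnion Z) ?_ ?_
    (fun z => (SignType.sign (fderiv ℝ f z).det : ℤ)) ?_, Finset.sum_biUnion ?_,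
    finsum_eq_sum_of_support_subset (s := I), Finset.sum_congr rfl fun i _ => hdegf i]
  · intro i hi
    by_contra hiI
    refine hi (brouwerDegree_eq_zero hVo hVb hf.continuous.continuousOn fun x hx hxi => ?_)
    exact hiI (hfI x hx i hxi)
  · intro i _ j _ hij
    refine Finset.disjoint_left.2 fun x hxi hxj => hij (rotationValue_injective ?_)
    rw [← ((hZ i x).1 hxi).2, ((hZ j x).1 hxj).2]
  · intro z hz
    obtain ⟨i, -, hi⟩ := Finset.mem_biUnion.1 hz
    exact ((hZ i z).1 hi).1
  · intro x hx h
    obtain ⟨i, hi⟩ := hΨ.exists_eq_rotationValue_of_polarShift (hnz x hx) (sub_eq_zero.1 h)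
    refine Finset.mem_biUnion.2 ⟨i, hfI x hx i hi, (hZ i x).2 ⟨?_, hi⟩⟩
    by_contra hxV
    exact hfne x (by rw [hVo.frontier_eq]; exact ⟨hx, hxV⟩) i hi
  · intro z hz
    obtain ⟨i, -, hi⟩ := Finset.mem_biUnion.1 hz
    obtain ⟨hzV, hzi⟩ := (hZ i z).1 hi
    exact hΨ.brouwerDegree_polarShift_ball hf (hnz z (subset_closure hzV)) hzi
      (hfreg _ (mem_range_self i) z hzi)

end IsPolarLike

/-! ### Vanishing outside `Σ`, the zero at the origin, and the theorem -/

theorem brouwerDegree_neg_ball {ε : ℝ} (hε : 0 < ε) :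
    brouwerDegree (fun x => -x) (Metric.ball 0 ε) 0 = 1 := by
  have hfd (x : ℝ × ℝ) : (fderiv ℝ (fun x : ℝ × ℝ => -x) x).det = 1 := by
    rw [det_prod_plane, fderiv_fun_neg, fderiv_fun_id]
    simp
  rw [brouwerDegree_of_regular Metric.isOpen_ball Metric.isBounded_ball contDiff_neg]
  · have : {x : ℝ × ℝ | x ∈ Metric.ball 0 ε ∧ -x = 0} = {0} := by
      ext x
      simp only [neg_eq_zero, mem_ofPred_eq, mem_singleton_iff, and_iff_right_iff_imp]
      rintro rfl
      exact Metric.mem_ball_self hε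
    rw [signedCount, this, finsum_mem_singleton, hfd, sign_one]
    rfl
  · intro x hx h
    rw [Metric.isOpen_ball.frontier_eq] at hx
    rw [neg_eq_zero.1 h] at hx
    exact hx.2 (Metric.mem_ball_self hε)
  · intro x _ _
    rw [hfd]
    exact one_ne_zero

/-- The map is deformed along segments to a constant `c` on the same side of `v`, one unit away. -/
theorem brouwerDegree_eq_zero_of_fst {g : ℝ × ℝ → ℝ × ℝ} {U : Set (ℝ × ℝ)} {v : ℝ × ℝ}
    (hUo : IsOpen U) (hUb : Bornology.IsBounded U) (hg : ContinuousOn g (closure U))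
    (h : (∀ x ∈ frontier U, (g x).1 < v.1) ∨ ∀ x ∈ frontier U, v.1 < (g x).1) :
    brouwerDegree g U v = 0 := by
  obtain ⟨c, hcv, hc⟩ : ∃ c : ℝ × ℝ, c.1 ≠ v.1 ∧ ∀ s ∈ Icc (0 : ℝ) 1, ∀ x ∈ frontier U,
      (g x).1 + s * (c.1 - (g x).1) ≠ v.1 := by
    rcases h with h | h
    · refine ⟨v - (1, 0), by simp, fun s hs x hx => ne_of_lt ?_⟩
      have := h x hx
      simp only [Prod.fst_sub]
      rcases hs.1.eq_or_lt with h' | h'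
      · rw [← h']; linarith
      · nlinarith [hs.2]
    · refine ⟨v + (1, 0), by simp, fun s hs x hx => ne_of_gt ?_⟩
      have := h x hx
      simp only [Prod.fst_add]
      rcases hs.1.eq_or_lt with h' | h'
      · rw [← h']; linarith
      · nlinarith [hs.2]
  rw [brouwerDegree_eq_of_segment hUo hUb hg (g₁ := fun _ => c) continuousOn_const
    fun s hs x hx h => hc s hs x hx (congrArg Prod.fst h)]
  exact brouwerDegree_eq_zero hUo hUb continuousOn_const fun x _ h => hcv (congrArg Prod.fst h)

/-- The degree vanishes at the rotation values outside of the convex hull of the rotations. -/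
theorem brouwerDegree_eq_zero_of_notMem_rotationIntegers {Ψ F g : ℝ × ℝ → ℝ × ℝ}
    {U : Set (ℝ × ℝ)} (hUo : IsOpen U) (hUb : Bornology.IsBounded U)
    (hg : ContinuousOn g (closure U)) (hgF : EqOn g (F ∘ polarInv Ψ) (frontier U)) {i : ℤ}
    (hi : i ∉ rotationIntegers Ψ F (frontier U)) : brouwerDegree g U (rotationValue i) = 0 := by
  have hrot (x : ℝ × ℝ) (hx : x ∈ frontier U) :
      (g x).1 = 2 * Real.pi * polarRotation Ψ F x := by
    rw [hgF hx, polarRotation, comp_apply, mul_div_cancel₀ _ Real.two_pi_pos.ne']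
  have hmem (x : ℝ × ℝ) (hx : x ∈ frontier U) :
      polarRotation Ψ F x ∈ convexHull ℝ (polarRotation Ψ F '' frontier U) :=
    subset_convexHull _ _ (mem_image_of_mem _ hx)
  have hord := (convex_convexHull ℝ (polarRotation Ψ F '' frontier U)).ordConnected
  refine brouwerDegree_eq_zero_of_fst hUo hUb hg ?_
  -- Otherwise some rotation is at least `i` and another at most `i`, which puts `i` in the convex
  -- hull.
  by_contra! hcon
  obtain ⟨⟨x, hx, hxi⟩, ⟨y, hy, hyi⟩⟩ := hcon
  rw [hrot x hx, rotationValue] at hxi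
  rw [hrot y hy, rotationValue] at hyi
  exact hi (hord.out (hmem y hy) (hmem x hx) ⟨le_of_mul_le_mul_left hyi Real.two_pi_pos,
    le_of_mul_le_mul_left hxi Real.two_pi_pos⟩)

/-- If the origin lies in `U`, boundary values extend to `U` in such a way that the displacement has
an additional zero of index `1` at the origin. -/
theorem IsPolarLike.exists_extension_of_zero_mem {Ψ : ℝ × ℝ → ℝ × ℝ} (hΨ : IsPolarLike Ψ)
    {U : Set (ℝ × ℝ)} (hUo : IsOpen U) (hUb : Bornology.IsBounded U) (h0 : 0 ∈ U)
    {γ : ℝ × ℝ → ℝ × ℝ} (hγ : ContinuousOn γ (frontier U))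
    (hν : ∀ x ∈ frontier U, ∀ i : ℤ, γ x ≠ rotationValue i) :
    ∃ g : ℝ × ℝ → ℝ × ℝ, Continuous g ∧ EqOn g γ (frontier U) ∧
      ContinuousOn (fun x => polarShift Ψ x (g x) - x) (closure U) ∧
      brouwerDegree (fun x => polarShift Ψ x (g x) - x) U 0 =
        1 + ∑ᶠ i : ℤ, brouwerDegree g U (rotationValue i) := by
  have hUfr : ∀ x ∈ frontier U, x ∉ U := fun x hx => by
    rw [hUo.frontier_eq] at hx
    exact hx.2
  obtain ⟨ε, hε, hεU⟩ := Metric.mem_nhds_iff.1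
    (Filter.inter_mem (hUo.mem_nhds h0) (hΨ.eventually_polarInv_snd_lt one_pos))
  let D : Set (ℝ × ℝ) := Metric.closedBall 0 (ε / 2)
  have hDsub : D ⊆ Metric.ball 0 ε := Metric.closedBall_subset_ball (half_lt_self hε)
  obtain ⟨g₀, hg₀, hg₀γ⟩ := exists_continuous_extension isClosed_frontier hγ
  obtain ⟨χ, hχ0, hχ1, -⟩ := exists_continuous_zero_one_of_isClosed
    (Metric.isClosed_closedBall : IsClosed D) (isClosed_frontier (s := U))
    (disjoint_left.2 fun x hx hx' => hUfr x hx' (hεU (hDsub hx)).1)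
  -- The second coordinate does all the work: `-1` pushes radii below `1` to the origin after
  -- clamping, and being nonzero it keeps `c` away from every `ν_i`.
  let c : ℝ × ℝ := (Real.pi, -1)
  -- The cutoff makes `g` equal to `c` near the origin and to the prescribed values on `∂U`.
  let g : ℝ × ℝ → ℝ × ℝ := fun x => c + χ x • (g₀ x - c)
  have hg : Continuous g := continuous_const.add (χ.continuous.smul (hg₀.sub continuous_const))
  have hgD : ∀ x ∈ D, g x = c := fun x hx => by
    simp [g, hχ0 hx]
  have hgγ : EqOn g γ (frontier U) := fun x hx => by
    simp [g, hχ1 hx, hg₀γ hx]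
  have hcν (i : ℤ) : c ≠ rotationValue i := fun h => by
    simpa [c, rotationValue] using congrArg Prod.snd h
  let f : ℝ × ℝ → ℝ × ℝ := fun x => polarShift Ψ x (g x) - x
  have hfD : ∀ x ∈ D, f x = -x := fun x hx => by
    have hr : (polarInv Ψ x + c).2 ≤ 0 := by
      have : (polarInv Ψ x).2 < 1 := (hεU (hDsub hx)).2
      simp only [Prod.snd_add, c]
      linarith
    simp only [f]
    rw [hgD x hx, polarShift, (hΨ.origin _ (clampRadius_mem _)).2 (max_eq_right hr), zero_sub]
  have hDnhds : D ∈ 𝓝 (0 : ℝ × ℝ) := Metric.closedBall_mem_nhds 0 (half_pos hε)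
  have hfc : Continuous f := continuous_iff_continuousAt.2 fun x => by
    by_cases hx : x = 0
    · subst hx
      exact continuous_neg.continuousAt.congr (Filter.eventually_of_mem hDnhds
        fun x hx => (hfD x hx).symm)
    · exact ((hΨ.continuousOn_polarShift.continuousAt
        ((isOpen_ne_fun continuous_fst continuous_const).mem_nhds
          (show ((x, g x) : (ℝ × ℝ) × (ℝ × ℝ)).1 ≠ 0 from hx))).comp₂
          continuousAt_id hg.continuousAt).sub continuousAt_id
  refine ⟨g, hg, hgγ, hfc.continuousOn, ?_⟩
  let B : Set (ℝ × ℝ) := Metric.ball 0 (ε / 2)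
  let V : Set (ℝ × ℝ) := U \ D
  have hVo : IsOpen V := hUo.sdiff Metric.isClosed_closedBall
  have hVU : V ⊆ U := sdiff_subset
  have hBU : B ⊆ U := fun x hx => (hεU (hDsub (Metric.ball_subset_closedBall hx))).1
  have hclV : ∀ x ∈ closure V, x ∉ B := fun x hx hxB =>
    disjoint_left.1 ((disjoint_left.2 fun x hx hxB => hx.2 (Metric.ball_subset_closedBall hxB) :
      Disjoint V B).closure_left Metric.isOpen_ball) hx hxB
  have hdiff : ∀ x ∈ closure U, x ∉ V → x ∈ frontier U ∨ x ∈ D := fun x hx hxV => by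
    by_cases hxU : x ∈ U
    · exact Or.inr (by_contra fun h => hxV ⟨hxU, h⟩)
    · exact Or.inl (by rw [hUo.frontier_eq]; exact ⟨hx, hxU⟩)
  have hgne : ∀ x ∈ closure U, x ∉ V → ∀ i : ℤ, g x ≠ rotationValue i := fun x hx hxV i => by
    rcases hdiff x hx hxV with h | h
    · rw [hgγ h]
      exact hν x h i
    · rw [hgD x h]
      exact hcν i
  have hB : brouwerDegree f B 0 = 1 := by
    rw [brouwerDegree_congr (g' := fun x => -x) fun x hx =>
      hfD x (Metric.closure_ball_subset_closedBall hx)]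
    exact brouwerDegree_neg_ball (half_pos hε)
  have hV : brouwerDegree f V 0 = ∑ᶠ i : ℤ, brouwerDegree g U (rotationValue i) := by
    refine (hΨ.brouwerDegree_polarShift hVo (hUb.subset hVU)
      (fun h => hclV 0 h (Metric.mem_ball_self (half_pos hε))) hg.continuousOn
      fun x hx i => hgne x (closure_mono hVU (frontier_subset_closure hx)) (fun hxV => by
        rw [hVo.frontier_eq] at hx
        exact hx.2 hxV) i).trans (finsum_congr fun i => ?_)
    exact (brouwerDegree_excision hUo hUb hg.continuousOn hVo hVU
      -- Removing `D` does not change the degrees of `g`, since `c` is no rotation value.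
      fun x hx => hgne x hx.1 hx.2 i).symm
  change brouwerDegree f U 0 = _
  rw [brouwerDegree_eq_sum hUo hUb hfc.continuousOn (Finset.univ : Finset Bool)
    (fun b => if b then B else V)]
  · simp [hB, hV]
  · rintro (_ | _) _
    · exact hVo
    · exact Metric.isOpen_ball
  · rintro (_ | _) _
    · exact hVU
    · exact hBU
  · have hVB : Disjoint V B := disjoint_left.2 fun x hx => hclV x (subset_closure hx)
    rintro (_ | _) _ (_ | _) _ h
    · exact absurd rfl h
    · exact hVB
    · exact hVB.symm
    · exact absurd rfl h
  · rintro x ⟨hx, hxBV⟩ hfx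
    have hxV : x ∉ V := fun h => hxBV (mem_biUnion (Finset.mem_univ false) h)
    have hxB : x ∉ B := fun h => hxBV (mem_biUnion (Finset.mem_univ true) h)
    have hx0 : x ≠ 0 := fun h => hxB (h ▸ Metric.mem_ball_self (half_pos hε))
    obtain ⟨i, hi⟩ := hΨ.exists_eq_rotationValue_of_polarShift hx0 (sub_eq_zero.1 hfx)
    exact hgne x hx hxV i hi

theorem mainTheorem2 (Ψ : ℝ × ℝ → ℝ × ℝ) (hΨ : IsPolarLike Ψ)
    (U : Set (ℝ × ℝ)) (hUo : IsOpen U) (hUb : Bornology.IsBounded U)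
    (T : ℝ) (hT : 0 ≤ T) (φ : ℝ → ℝ × ℝ → ℝ × ℝ)
    (hφ : ContinuousOn (Function.uncurry φ) (Set.Icc 0 T ×ˢ closure U))
    (hφ0 : ∀ x ∈ closure U, φ 0 x = x)
    (hφN : ∀ t ∈ Set.Icc 0 T, ∀ x ∈ frontier U, φ t x ≠ 0)
    (hφT : ∀ x ∈ frontier U, φ T x ≠ x) :
    IsEvolutionLift Ψ T φ (frontier U) (evolutionLift Ψ T φ (frontier U)) ∧
    ((0 : ℝ × ℝ) ∈ U →
      brouwerDegree (fun x => φ T x - x) U 0 =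
        1 + ∑ᶠ i ∈ rotationIntegers Ψ (liftedDisplacement Ψ T φ (frontier U)) (frontier U),
          polarDegree Ψ (liftedDisplacement Ψ T φ (frontier U)) U (rotationValue i)) ∧
    ((0 : ℝ × ℝ) ∉ closure U →
      brouwerDegree (fun x => φ T x - x) U 0 =
        ∑ᶠ i ∈ rotationIntegers Ψ (liftedDisplacement Ψ T φ (frontier U)) (frontier U),
          polarDegree Ψ (liftedDisplacement Ψ T φ (frontier U)) U (rotationValue i)) := by
  have hTmem : T ∈ Icc 0 T := right_mem_Icc.2 hT
  have h0fr : (0 : ℝ × ℝ) ∉ frontier U := fun h =>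
    hφN 0 (left_mem_Icc.2 hT) 0 h (hφ0 0 (frontier_subset_closure h))
  have hlift := hΨ.isEvolutionLift_evolutionLift (E := frontier U) hT
    (hφ.mono (prod_mono_right frontier_subset_closure))
    (fun x hx => hφ0 x (frontier_subset_closure hx)) hφN
  refine ⟨hlift, ?_⟩
  set Φ := evolutionLift Ψ T φ (frontier U)
  set F := liftedDisplacement Ψ T φ (frontier U)
  have hFdef (y : ℝ × ℝ) : F y = Φ T y - y := rfl
  have hF : ContinuousOn F (polarPreimage Ψ (frontier U)) :=
    (hlift.continuousOn.comp (continuousOn_const.prodMk continuousOn_id)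
      fun y hy => ⟨hTmem, hy⟩).sub continuousOn_id
  have hper : ∀ y ∈ polarPreimage Ψ (frontier U), ∀ k : ℤ, F (y + rotationValue k) = F y :=
    fun y hy k => by
      rw [hFdef, hFdef, hlift.add_rotationValue hΨ hT hy, add_sub_add_right_eq_sub]
  have hγ : ContinuousOn (F ∘ polarInv Ψ) (frontier U) :=
    hΨ.continuousOn_comp_polarInv h0fr hF hper
  have hshift : ∀ x ∈ frontier U, polarShift Ψ x ((F ∘ polarInv Ψ) x) = φ T x := fun x hx => by
    have hy := hΨ.polarInv_mem_polarPreimage hx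
    rw [polarShift, comp_apply, hFdef, add_sub_cancel,
      clampRadius_of_nonneg (le_of_lt (hlift.mem T hTmem _ hy)), hlift.lift T hTmem _ hy,
      hΨ.apply_polarInv]
  -- A shift by `ν_i` is the identity, so such an `x` would be a fixed point of `φ T` on the
  -- boundary.
  have hν : ∀ x ∈ frontier U, ∀ i : ℤ, (F ∘ polarInv Ψ) x ≠ rotationValue i := fun x hx i h => by
    have := hshift x hx
    rw [h, hΨ.polarShift_rotationValue] at this
    exact hφT x hx this.symm
  have hφTc : ContinuousOn (fun x => φ T x - x) (closure U) :=
    (hφ.comp (continuousOn_const.prodMk continuousOn_id) fun x hx => ⟨hTmem, hx⟩).sub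
      continuousOn_id
  -- Summing over `Σ` or over all of `ℤ` is the same, because the degrees vanish off `Σ`.
  have hsum (g : ℝ × ℝ → ℝ × ℝ) (hg : Continuous g) (hgF : EqOn g (F ∘ polarInv Ψ) (frontier U)) :
      ∑ᶠ i ∈ rotationIntegers Ψ F (frontier U), polarDegree Ψ F U (rotationValue i) =
        ∑ᶠ i : ℤ, brouwerDegree g U (rotationValue i) := by
    rw [← finsum_mem_univ fun i : ℤ => brouwerDegree g U (rotationValue i)]
    refine (finsum_mem_congr rfl fun i _ => polarDegree_eq_brouwerDegree hΨ hUo hUb h0fr hF hper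
      hg.continuousOn hgF fun x hx => hgF hx ▸ hν x hx i).trans ?_
    refine finsum_mem_inter_support_eq' _ _ _ fun i hi => iff_of_true ?_ (mem_univ i)
    by_contra hi'
    exact hi (brouwerDegree_eq_zero_of_notMem_rotationIntegers hUo hUb hg.continuousOn hgF hi')
  have hdeg (g : ℝ × ℝ → ℝ × ℝ) (hgF : EqOn g (F ∘ polarInv Ψ) (frontier U))
      (hgc : ContinuousOn (fun x => polarShift Ψ x (g x) - x) (closure U)) :
      brouwerDegree (fun x => φ T x - x) U 0 =
        brouwerDegree (fun x => polarShift Ψ x (g x) - x) U 0 :=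
    brouwerDegree_eq_of_eqOn_frontier hUo hUb hφTc hgc
      (fun x hx => by simp only [hgF hx, hshift x hx])
      fun x hx => sub_ne_zero.2 (hφT x hx)
  refine ⟨fun h0 => ?_, fun h0 => ?_⟩
  · obtain ⟨g, hg, hgF, hgc, hgdeg⟩ := hΨ.exists_extension_of_zero_mem hUo hUb h0 hγ hν
    rw [hsum g hg hgF, hdeg g hgF hgc, hgdeg]
  · obtain ⟨g, hg, hgF⟩ := exists_continuous_extension isClosed_frontier hγ
    have hgc : ContinuousOn (fun x => polarShift Ψ x (g x) - x) (closure U) :=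
      (hΨ.continuousOn_polarShift.comp (continuousOn_id.prodMk hg.continuousOn)
        fun x hx h => h0 (h ▸ hx)).sub continuousOn_id
    rw [hsum g hg hgF, hdeg g hgF hgc, hΨ.brouwerDegree_polarShift hUo hUb h0 hg.continuousOn
      fun x hx i => hgF hx ▸ hν x hx i]
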